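/- Let $1\le n<p$, let $X\in\mathbb{R}^{n\times p}$ be such that every $n$ columns of $X$ are linearly independent, let $w_1,\dots,w_p>0$, $W=\mathrm{diag}(w_i)$, $\lambda>0$, $\sigma>0$ and $\mu_0\in\mathbb{R}^n$, and put $\Psi=X^{\mathsf T}X/n$. Let $y\sim\mathcal N_n(\mu_0,\sigma^2\mathbf I_n)$. Assume that the lasso problem has at most one minimizer for every response in $\mathbb{R}^n$, and let $$\hat\beta(y)=\arg\min_{\beta\in\mathbb{R}^p}\ \frac1{2n}\|y-X\beta\|_2^2+\lambda\sum_{i=1}^p w_i|\beta_i| ,\qquad \mathcal A=\mathrm{supp}(\hat\beta(y)).$$ Let $S=S(y)$ be the subgradient of the $\ell_1$ norm at $\hat\beta(y)$ that is determined by the KKT equation $\frac1nX^{\mathsf T}y=\Psi\hat\beta+\lambda WS$. Let $V$ be a $p\times p$ orthogonal matrix whose first $n$ columns $V_R$ are eigenvectors of $\Psi$ with the positive eigenvalues $\Lambda_1,\dots,\Lambda_n$, and whose last $p-n$ columns $V_N$ form a basis of $\mathrm{null}(X)$. Let $f_R(\,\cdot\,;\sigma^2)$ be the density of $\mathcal N_n(0,\tfrac{\sigma^2}{n}\mathrm{diag}(\Lambda_1,\dots,\Lambda_n))$.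 Fix $A\subset\{1,\dots,p\}$ with $\mathbb P(\mathcal A=A)>0$, and let $I=\{1,\dots,p\}\setminus A$. For $\theta=(b_A,s_I)\in\mathbb{R}^A\times\mathbb{R}^I$ let $b\in\mathbb{R}^p$ be the vector that equals $b_A$ on $A$ and $0$ on $I$, let $s\in\mathbb{R}^p$ be the vector that equals $\mathrm{sgn}(b_A)$ on $A$ and $s_I$ on $I$, and put $$H(\theta,A;\mu_0,\lambda)=\Psi b+\lambda Ws-\tfrac1nX^{\mathsf T}\mu_0 .$$ Call $\theta$ feasible if $$V_{AN}^{\mathsf T}W_{AA}\,\mathrm{sgn}(b_A)+V_{IN}^{\mathsf T}W_{II}\,s_I=0\qquad\text{and}\qquad\|s_I\|_\infty\le 1 .$$ Then $|A|\le n$, and the following hold. 1. For every $F\subset I$ with $|F|=n-|A|$, each $(b_A,s_F)\in\mathbb{R}^A\times\mathbb{R}^F\cong\mathbb{R}^n$ determines exactly one $s_I\in\mathbb{R}^I$ that satisfies the first (equality) constraint and has the coordinates $s_F$ on $F$; write $\theta(b_A,s_F)=(b_A,s_I)$. The conditional distribution of $(\hat\beta_A,S_I)$ given $\mathcal A=A$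 has, in the parameterization $\theta=\theta(b_A,s_F)$, a density with respect to Lebesgue measure $db_A\,ds_F$ on $\mathbb{R}^n$ that is proportional to $$f_R\big(V_R^{\mathsf T}H(\theta,A;\mu_0,\lambda);\sigma^2\big)$$ on the set of those $(b_A,s_F)$ for which $\theta(b_A,s_F)$ is feasible, and is $0$ elsewhere. The normalizing integral is positive and finite. 2. The same holds for the parameterization $\theta=(b_A,\,s^0(\mathrm{sgn}(b_A))+Bt)$, $t\in\mathbb{R}^{n-|A|}$, with density taken with respect to $db_A\,dt$, for every matrix $B$ whose columns form an orthonormal basis of $\mathrm{null}(V_{IN}^{\mathsf T}W_{II})$ and every choice $s^0(\cdot)$ of a particular solution $s_I$ of the equality constraint as a function of the sign vector $\mathrm{sgn}(b_A)\in\{-1,1\}^A$. -/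

import Mathlib

open MeasureTheory ProbabilityTheory Matrix

noncomputable section

namespace CondLasso

/-! ## The lasso and its augmented estimator -/

/-- The Gram matrix `Ψ = Xᵀ X / n`. -/
def gram {n p : ℕ} (X : Matrix (Fin n) (Fin p) ℝ) : Matrix (Fin p) (Fin p) ℝ :=
  (1 / (n : ℝ)) • (Xᵀ * X)

/-- The lasso objective `‖y - X b‖₂² / (2 n) + lam * ∑ j, w j * |b j|`. -/
def lassoObjective {n p : ℕ} (X : Matrix (Fin n) (Fin p) ℝ) (w : Fin p → ℝ) (lam : ℝ)
    (y : Fin n → ℝ) (b : Fin p → ℝ) : ℝ :=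
  1 / (2 * (n : ℝ)) * ∑ i, (y i - (X *ᵥ b) i) ^ 2 + lam * ∑ j, w j * |b j|

/-- `b` is a global minimizer of the lasso objective for the response `y`. -/
def IsLassoSolution {n p : ℕ} (X : Matrix (Fin n) (Fin p) ℝ) (w : Fin p → ℝ) (lam : ℝ)
    (y : Fin n → ℝ) (b : Fin p → ℝ) : Prop :=
  ∀ b' : Fin p → ℝ, lassoObjective X w lam y b ≤ lassoObjective X w lam y b'

/-- The support of a coefficient vector. -/
def activeSet {p : ℕ} (b : Fin p → ℝ) : Finset (Fin p) :=
  Finset.univ.filter (fun j => b j ≠ 0)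

/-- The vector `S` solving the KKT equation `Xᵀ y / n = Ψ b + lam W S` (`lam ≠ 0`, `w j ≠ 0`).
At a lasso solution it is a subgradient of the `ℓ¹` norm; see `lassoSubgradient_kkt` and
`lassoSubgradient_isSubgradient`. -/
def lassoSubgradient {n p : ℕ} (X : Matrix (Fin n) (Fin p) ℝ) (w : Fin p → ℝ) (lam : ℝ)
    (y : Fin n → ℝ) (b : Fin p → ℝ) : Fin p → ℝ :=
  fun j => ((1 / (n : ℝ)) * (Xᵀ *ᵥ y) j - (gram X *ᵥ b) j) / (lam * w j)

/-- `lassoSubgradient` is the unique solution of the KKT equation. -/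
theorem lassoSubgradient_kkt {n p : ℕ} (X : Matrix (Fin n) (Fin p) ℝ) (w : Fin p → ℝ)
    (lam : ℝ) (hw : ∀ j, 0 < w j) (hlam : 0 < lam) (y : Fin n → ℝ) (b s : Fin p → ℝ) :
    (1 / (n : ℝ)) • (Xᵀ *ᵥ y) = gram X *ᵥ b + lam • (Matrix.diagonal w *ᵥ s) ↔
      s = lassoSubgradient X w lam y b := by
  have h : ∀ j, lam * w j ≠ 0 := fun j => (mul_pos hlam (hw j)).ne'
  rw [funext_iff, funext_iff]
  refine forall_congr' fun j => ?_
  simp only [lassoSubgradient, Pi.smul_apply, Pi.add_apply, smul_eq_mul,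
    Matrix.mulVec_diagonal, eq_div_iff (h j)]
  constructor <;> intro H <;> linarith

/-- At a lasso solution, `lassoSubgradient` is a subgradient of the `ℓ¹` norm. -/
theorem lassoSubgradient_isSubgradient {n p : ℕ} (hn : 0 < n) (X : Matrix (Fin n) (Fin p) ℝ)
    (w : Fin p → ℝ) (lam : ℝ) (hw : ∀ j, 0 < w j) (hlam : 0 < lam) (y : Fin n → ℝ)
    (b : Fin p → ℝ) (hb : IsLassoSolution X w lam y b) (j : Fin p) :
    (b j ≠ 0 → lassoSubgradient X w lam y b j = Real.sign (b j)) ∧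
      |lassoSubgradient X w lam y b j| ≤ 1 := by
  obtain ⟨k, hk, key⟩ : ∃ k : ℝ, 0 ≤ k ∧ ∀ t : ℝ,
      t * (lam * w j * lassoSubgradient X w lam y b j) ≤
        t ^ 2 * k + lam * w j * (|b j + t| - |b j|) := by
    have hn' : (n : ℝ) ≠ 0 := by positivity
    have hl : lam * w j ≠ 0 := (mul_pos hlam (hw j)).ne'
    refine ⟨1 / (2 * (n : ℝ)) * ∑ i, X i j ^ 2, by positivity, fun t => ?_⟩
    have h := hb (b + Pi.single j t)
    have h1 : ∀ i, (X *ᵥ (b + Pi.single j t)) i = (X *ᵥ b) i + X i j * t := by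
      intro i
      simp [Matrix.mulVec_add, mul_comm]
    have h2 : ∑ i, w i * |(b + Pi.single j t : Fin p → ℝ) i| =
        ∑ i, w i * |b i| + w j * (|b j + t| - |b j|) := by
      rw [← sub_eq_iff_eq_add', ← Finset.sum_sub_distrib, Finset.sum_eq_single j]
      · simp; ring
      · intro i _ hij
        simp [Pi.single_eq_of_ne hij]
      · simp
    have h3 : lam * w j * lassoSubgradient X w lam y b j =
        1 / (n : ℝ) * ∑ i, X i j * (y i - (X *ᵥ b) i) := by
      rw [lassoSubgradient, mul_div_cancel₀ _ hl, gram, Matrix.smul_mulVec,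
        ← Matrix.mulVec_mulVec, Pi.smul_apply, smul_eq_mul, ← mul_sub]
      congr 1
      simp only [mul_sub, Finset.sum_sub_distrib]
      rfl
    have h4 : ∑ i, (y i - ((X *ᵥ b) i + X i j * t)) ^ 2 =
        ∑ i, (y i - (X *ᵥ b) i) ^ 2 - 2 * t * ∑ i, X i j * (y i - (X *ᵥ b) i)
          + t ^ 2 * ∑ i, X i j ^ 2 := by
      rw [Finset.mul_sum, Finset.mul_sum, ← Finset.sum_sub_distrib, ← Finset.sum_add_distrib]
      exact Finset.sum_congr rfl fun i _ => by ring
    simp only [lassoObjective, h1, h2, h4] at h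
    rw [h3]
    have h5 : 1 / (n : ℝ) = 2 * (1 / (2 * (n : ℝ))) := by field_simp
    rw [h5]
    linarith
  have hc : 0 < lam * w j := mul_pos hlam (hw j)
  generalize lassoSubgradient X w lam y b j = s at key
  generalize lam * w j = c at key hc
  generalize b j = β at key
  -- along a direction in which `|β + t| - |β| ≤ t * a` for small `t > 0`, the slope is at most `a`
  have lim : ∀ u v : ℝ, (∃ δ > 0, ∀ t, 0 < t → t < δ → t * u ≤ t ^ 2 * k + t * v) → u ≤ v := by
    rintro u v ⟨δ, hδ, h⟩
    by_contra! huv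
    have hk1 : 0 < k + 1 := by linarith
    have ht : 0 < min (δ / 2) ((u - v) / (k + 1)) :=
      lt_min (by linarith) (div_pos (by linarith) hk1)
    have h1 := h _ ht (lt_of_le_of_lt (min_le_left _ _) (by linarith))
    have h2 : min (δ / 2) ((u - v) / (k + 1)) * (k + 1) ≤ u - v :=
      (le_div_iff₀ hk1).1 (min_le_right _ _)
    generalize min (δ / 2) ((u - v) / (k + 1)) = t at ht h1 h2
    have h3 : u ≤ t * k + v := by
      refine le_of_mul_le_mul_left ?_ ht
      linarith [h1]
    linarith
  have up : s ≤ 1 := by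
    refine le_of_mul_le_mul_left (lim (c * s) (c * 1) ⟨1, one_pos, fun t ht _ => ?_⟩) hc
    have h1 := key t
    have h2 : |β + t| - |β| ≤ t := by have := abs_add_le β t; rw [abs_of_pos ht] at this; linarith
    nlinarith [mul_le_mul_of_nonneg_left h2 hc.le]
  have dn : -1 ≤ s := by
    have := le_of_mul_le_mul_left (lim (c * (-s)) (c * 1) ⟨1, one_pos, fun t ht _ => ?_⟩) hc
    · linarith
    have h1 := key (-t)
    have h2 : |β + -t| - |β| ≤ t := by
      have := abs_add_le β (-t); rw [abs_neg, abs_of_pos ht] at this; linarith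
    nlinarith [mul_le_mul_of_nonneg_left h2 hc.le]
  refine ⟨fun hβ => ?_, abs_le.2 ⟨dn, up⟩⟩
  rcases lt_or_gt_of_ne hβ with hneg | hpos
  · rw [Real.sign_of_neg hneg]
    refine le_antisymm ?_ dn
    refine le_of_mul_le_mul_left (lim (c * s) (c * (-1)) ⟨-β, by linarith, fun t ht ht' => ?_⟩) hc
    have h1 := key t
    rw [abs_of_neg hneg, abs_of_neg (by linarith : β + t < 0)] at h1
    linarith
  · rw [Real.sign_of_pos hpos]
    refine le_antisymm up ?_
    have := le_of_mul_le_mul_left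
      (lim (c * (-s)) (c * (-1)) ⟨β, hpos, fun t ht ht' => ?_⟩) hc
    · linarith
    have h1 := key (-t)
    rw [abs_of_pos hpos, abs_of_pos (by linarith : 0 < β + -t)] at h1
    linarith

/-! ## Block notation: `A` is the active set, `I` its complement -/

/-- Index type of the first `n` columns of `V`. -/
abbrev RIdx (n p : ℕ) : Type := {j : Fin p // (j : ℕ) < n}

/-- Index type of the last `p - n` columns of `V`. -/
abbrev NIdx (n p : ℕ) : Type := {j : Fin p // n ≤ (j : ℕ)}

/-- `V_R`: the first `n` columns of `V`. -/
def colsR (n : ℕ) {p : ℕ} (V : Matrix (Fin p) (Fin p) ℝ) : Matrix (Fin p) (RIdx n p) ℝ :=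
  V.submatrix id Subtype.val

/-- `V_N`: the last `p - n` columns of `V`. -/
def colsN (n : ℕ) {p : ℕ} (V : Matrix (Fin p) (Fin p) ℝ) : Matrix (Fin p) (NIdx n p) ℝ :=
  V.submatrix id Subtype.val

/-- `V` is an orthogonal `p × p` matrix whose first `n` columns are eigenvectors of
`Ψ = Xᵀ X / n` with the positive eigenvalues `L` and whose last `p - n` columns form a basis of
the null space of `X`. -/
structure IsSpectralFrame {n p : ℕ} (X : Matrix (Fin n) (Fin p) ℝ)
    (V : Matrix (Fin p) (Fin p) ℝ) (L : RIdx n p → ℝ) : Prop where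
  orthogonal : V ∈ Matrix.orthogonalGroup (Fin p) ℝ
  eigen_pos : ∀ k, 0 < L k
  eigen : ∀ k : RIdx n p, gram X *ᵥ (colsR n V).col k = L k • (colsR n V).col k
  null : Submodule.span ℝ (Set.range (colsN n V).col) = LinearMap.ker X.mulVecLin

/-- Index type of the complement `I` of `A`. -/
abbrev Inactive {p : ℕ} (A : Finset (Fin p)) : Type := {j : Fin p // j ∉ A}

/-- The space of `θ = (b_A, s_I)`. -/
abbrev Theta {p : ℕ} (A : Finset (Fin p)) : Type := (A → ℝ) × (Inactive A → ℝ)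

/-- Componentwise sign. -/
def sgn {ι : Type*} (b : ι → ℝ) : ι → ℝ := fun i => Real.sign (b i)

/-- The `p`-vector `b` with `b_A` on `A` and `0` on `I`. -/
def fullCoef {p : ℕ} (A : Finset (Fin p)) (θ : Theta A) : Fin p → ℝ :=
  fun j => if h : j ∈ A then θ.1 ⟨j, h⟩ else 0

/-- The `p`-vector `s` with `sgn b_A` on `A` and `s_I` on `I`. -/
def fullSubgrad {p : ℕ} (A : Finset (Fin p)) (θ : Theta A) : Fin p → ℝ :=
  fun j => if h : j ∈ A then sgn θ.1 ⟨j, h⟩ else θ.2 ⟨j, h⟩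

/-- `(β_A, s_I)` for `p`-vectors `β` and `s`. -/
def restrictTheta {p : ℕ} (A : Finset (Fin p)) (β s : Fin p → ℝ) : Theta A :=
  (fun j => β j, fun j => s j)

/-- `H(θ, A; μ₀, lam) = Ψ b + lam W s - Xᵀ μ₀ / n`. -/
def Hmap {n p : ℕ} (X : Matrix (Fin n) (Fin p) ℝ) (w : Fin p → ℝ) (lam : ℝ)
    (mu0 : Fin n → ℝ) (A : Finset (Fin p)) (θ : Theta A) : Fin p → ℝ :=
  gram X *ᵥ fullCoef A θ + lam • (Matrix.diagonal w *ᵥ fullSubgrad A θ)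
    - (1 / (n : ℝ)) • (Xᵀ *ᵥ mu0)

/-- `f_R(r; σ²)`: the density at `r` of the Gaussian distribution with mean `0` and covariance
matrix `(σ² / n) diag(L)`, as the product of the one-dimensional densities. -/
def densR {n p : ℕ} (L : RIdx n p → ℝ) (sig : ℝ) (r : RIdx n p → ℝ) : ℝ :=
  ∏ k, gaussianPDFReal 0 (Real.toNNReal (sig ^ 2 * L k / n)) (r k)

/-- `V_{AN}ᵀ W_{AA}`. -/
def blockA (n : ℕ) {p : ℕ} (V : Matrix (Fin p) (Fin p) ℝ) (w : Fin p → ℝ)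
    (A : Finset (Fin p)) : Matrix (NIdx n p) A ℝ :=
  ((colsN n V).submatrix Subtype.val id)ᵀ * Matrix.diagonal (fun j : A => w j)

/-- `V_{IN}ᵀ W_{II}`. -/
def blockI (n : ℕ) {p : ℕ} (V : Matrix (Fin p) (Fin p) ℝ) (w : Fin p → ℝ)
    (A : Finset (Fin p)) : Matrix (NIdx n p) (Inactive A) ℝ :=
  ((colsN n V).submatrix Subtype.val id)ᵀ * Matrix.diagonal (fun j : Inactive A => w j)

/-- The equation `V_{AN}ᵀ W_{AA} σ + V_{IN}ᵀ W_{II} s_I = 0`, where `σ` is a sign vector. -/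
def NullEq (n : ℕ) {p : ℕ} (V : Matrix (Fin p) (Fin p) ℝ) (w : Fin p → ℝ)
    (A : Finset (Fin p)) (σ : A → ℝ) (s : Inactive A → ℝ) : Prop :=
  blockA n V w A *ᵥ σ + blockI n V w A *ᵥ s = 0

/-- The constraint set for `θ = (b_A, s_I)`: the null-space equation with `σ = sgn b_A`, and
`‖s_I‖_∞ ≤ 1` (the norm of a function type is the sup norm). -/
def feasible (n : ℕ) {p : ℕ} (V : Matrix (Fin p) (Fin p) ℝ) (w : Fin p → ℝ)
    (A : Finset (Fin p)) : Set (Theta A) :=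
  {θ | NullEq n V w A (sgn θ.1) θ.2 ∧ ‖θ.2‖ ≤ 1}

/-! ## The target measure -/

/-- The unnormalized target measure on the space of `θ`, written through a parameterization `φ` of
the solutions of the null-space equation by `ℝ^A × ℝ^K`: on the parameter space it has Lebesgue
density `f_R(V_Rᵀ H(θ, A; μ₀, lam); σ²)` with `θ = φ (b_A, t)`, restricted to the parameters whose
`θ` is feasible. -/
def targetMeasure {n p : ℕ} (X : Matrix (Fin n) (Fin p) ℝ) (w : Fin p → ℝ) (lam sig : ℝ)
    (mu0 : Fin n → ℝ) (V : Matrix (Fin p) (Fin p) ℝ) (L : RIdx n p → ℝ) (A : Finset (Fin p))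
    {K : Type} [Fintype K] (φ : (A → ℝ) × (K → ℝ) → Theta A) : Measure (Theta A) :=
  ((volume : Measure ((A → ℝ) × (K → ℝ))).withDensity
    ({x | φ x ∈ feasible n V w A}.indicator fun x =>
      ENNReal.ofReal (densR L sig ((colsR n V)ᵀ *ᵥ Hmap X w lam mu0 A (φ x))))).map φ

/-- `ν` is the normalization of the nonzero finite measure `μ` to a probability measure. -/
def IsNormalizationOf {E : Type*} [MeasurableSpace E] (ν μ : Measure E) : Prop :=
  μ Set.univ ≠ 0 ∧ μ Set.univ ≠ ⊤ ∧ ν = (μ Set.univ)⁻¹ • μ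

end CondLasso

end

open CondLasso

namespace CondLasso

/-! The KKT equation recovers the response from the coefficients and the subgradient: since `X` has
full row rank, `Xᵀ` is injective, and `Ψ b + λ W s` has the form `Xᵀ y / n` exactly when it is
orthogonal to `null(X)`, that is, when `V_Nᵀ W s = 0`.

Fix `A` and a sign vector `σ` on `A`. The subgradients with signs `σ` that solve the null-space
equation form an affine space `c σ + range M`, so `(b_A, t)` maps affinely to a response
(`signResponse`). By general position its linear part is injective between spaces of dimension `n`,
and it does not depend on `σ`. Hence every sign vector gives a bijection onto `ℝⁿ` with the same
Jacobian factor (`exists_measurableEquiv_signResponse`). Because KKT is necessary and sufficient and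
the minimizer is unique, the feasible parameters with `sgn b_A = σ` are exactly the preimage of the
responses with active set `A` and active signs `σ` (`preimage_signResponse`).

On such parameters `H = Xᵀ (y - μ₀) / n`, and the quadratic form of `f_R` at `V_Rᵀ H` is `‖y - μ₀‖²
/ σ²`, now with `σ²` the noise variance. So `f_R` is a constant times the Gaussian density of the
response (`exists_densR_eq`). Summing over sign vectors, and discarding the null set where some
coordinate of `b_A` vanishes, makes the target measure a positive finite multiple of the law
restricted to the event (`exists_targetMeasure_eq`). Normalization removes the multiple.

Both parameterizations in the theorem are instances of `IsNullParam`, so one argument serves for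
both. -/

/-! ### Density of an isotropic Gaussian vector -/

theorem map_toLp_pi_gaussianReal {ι : Type*} [Fintype ι] [DecidableEq ι]
    (m : EuclideanSpace ℝ ι) (s : ℝ) :
    (Measure.pi fun i => gaussianReal (m i) (Real.toNNReal (s ^ 2))).map (WithLp.toLp 2) =
      multivariateGaussian m (s ^ 2 • (1 : Matrix ι ι ℝ)) := by
  have hS : (s ^ 2 • (1 : Matrix ι ι ℝ)).PosSemidef := Matrix.PosSemidef.one.smul (sq_nonneg s)
  -- Both characteristic functions are `exp (i ⟨t, m⟩ - s² ‖t‖² / 2)`.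
  apply Measure.ext_of_charFun (E := EuclideanSpace ℝ ι)
  ext t
  rw [charFun_pi, charFun_multivariateGaussian hS]
  simp_rw [charFun_gaussianReal]
  rw [← Complex.exp_sum]
  congr 1
  rw [Finset.sum_sub_distrib, ← Finset.sum_mul, ← Finset.sum_div]
  congr 2
  · simp [PiLp.inner_apply, mul_comm]
  · simp only [Matrix.smul_mulVec, Matrix.one_mulVec, dotProduct, Real.coe_toNNReal _ (sq_nonneg s)]
    push_cast
    exact Finset.sum_congr rfl fun i _ => by
      rw [Pi.smul_apply, smul_eq_mul]; push_cast; ring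

theorem pi_gaussianReal_eq_withDensity {ι : Type*} [Fintype ι] (m : ι → ℝ) {v : NNReal}
    (hv : v ≠ 0) :
    Measure.pi (fun i => gaussianReal (m i) v) =
      (volume : Measure (ι → ℝ)).withDensity
        fun x => ENNReal.ofReal (∏ i, gaussianPDFReal (m i) v (x i)) := by
  classical
  refine Measure.pi_eq fun s hs => ?_
  have hg : ∀ i, Integrable ((s i).indicator (gaussianPDFReal (m i) v)) := fun i =>
    (integrable_gaussianPDFReal _ _).indicator (hs i)
  have hg0 : ∀ i x, 0 ≤ (s i).indicator (gaussianPDFReal (m i) v) x := fun i x =>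
    Set.indicator_nonneg (fun x _ => gaussianPDFReal_nonneg _ _ x) x
  -- Product measures are determined on boxes, and the indicator of a box factors over the
  -- coordinates, so Fubini reduces the claim to dimension one.
  have hprod : ∀ x : ι → ℝ, (Set.univ.pi s).indicator
      (fun x => ENNReal.ofReal (∏ i, gaussianPDFReal (m i) v (x i))) x =
      ENNReal.ofReal (∏ i, (s i).indicator (gaussianPDFReal (m i) v) (x i)) := by
    intro x
    by_cases hx : x ∈ Set.univ.pi s
    · rw [Set.indicator_of_mem hx]
      congr 1
      exact Finset.prod_congr rfl fun i _ => (Set.indicator_of_mem (hx i trivial) _).symm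
    · rw [Set.indicator_of_notMem hx]
      obtain ⟨i, hi⟩ : ∃ i, x i ∉ s i := by simpa [Set.mem_pi] using hx
      rw [Finset.prod_eq_zero (Finset.mem_univ i) (Set.indicator_of_notMem hi _),
        ENNReal.ofReal_zero]
  rw [withDensity_apply _ (MeasurableSet.univ_pi hs), ← lintegral_indicator (MeasurableSet.univ_pi hs)]
  simp_rw [hprod]
  rw [← ofReal_integral_eq_lintegral_ofReal (volume_pi (α := fun _ : ι => ℝ) ▸
      Integrable.fintype_prod hg)
    (Filter.Eventually.of_forall fun x => Finset.prod_nonneg fun i _ => hg0 i _),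
    integral_fintype_prod_volume_eq_prod (fun i => (s i).indicator (gaussianPDFReal (m i) v)),
    ENNReal.ofReal_prod_of_nonneg fun i _ => integral_nonneg (hg0 i)]
  refine Finset.prod_congr rfl fun i _ => ?_
  rw [gaussianReal_apply_eq_integral _ hv, integral_indicator (hs i)]

/-- The coordinates of an isotropic Gaussian vector have the product Gaussian density. -/
theorem hasLaw_ofLp_of_isotropic {ι : Type*} [Fintype ι] [DecidableEq ι] {Ω : Type*}
    [MeasurableSpace Ω] {P : Measure Ω} {m : EuclideanSpace ℝ ι} {s : ℝ} (hs : 0 < s)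
    {y : Ω → EuclideanSpace ℝ ι}
    (hy : HasLaw y (multivariateGaussian m (s ^ 2 • (1 : Matrix ι ι ℝ))) P) :
    HasLaw (fun ω => (y ω).ofLp) ((volume : Measure (ι → ℝ)).withDensity
        fun x => ENNReal.ofReal (∏ i, gaussianPDFReal (m i) (Real.toNNReal (s ^ 2)) (x i))) P := by
  have hv : Real.toNNReal (s ^ 2) ≠ 0 := by
    rw [Ne, Real.toNNReal_eq_zero, not_le]; positivity
  rw [← pi_gaussianReal_eq_withDensity _ hv]
  refine HasLaw.fun_comp (Y := fun z : EuclideanSpace ℝ ι => z.ofLp) ⟨by fun_prop, ?_⟩ hy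
  rw [← map_toLp_pi_gaussianReal, Measure.map_map (by fun_prop) (by fun_prop)]
  exact Measure.map_id

/-! ### Sizes of the column blocks `V_R` and `V_N` -/

variable {n p : ℕ}

theorem card_RIdx (h : n ≤ p) : Fintype.card (RIdx n p) = n := by
  rw [Fintype.card_subtype]
  conv_rhs => rw [← Finset.card_range n]
  refine Finset.card_bij (fun j _ => j.1) (by simp) (fun _ _ _ _ h => Fin.ext h) fun j hj => ?_
  have := Finset.mem_range.1 hj
  exact ⟨⟨j, by omega⟩, by simpa using this, rfl⟩

theorem card_NIdx : Fintype.card (NIdx n p) = p - n := by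
  have h : (Finset.univ.filter fun j : Fin p => n ≤ (j : ℕ)) =
      (Finset.univ.filter fun j : Fin p => (j : ℕ) < n)ᶜ := by
    ext j; simp
  rw [Fintype.card_subtype, h, Finset.card_compl, Fintype.card_fin]
  rcases le_or_gt n p with hnp | hnp
  · rw [← Fintype.card_subtype, card_RIdx hnp]
  · rw [Finset.filter_true_of_mem fun j _ => by omega]
    simp; omega

/-! ### The spectral frame -/

namespace IsSpectralFrame

variable {X : Matrix (Fin n) (Fin p) ℝ} {V : Matrix (Fin p) (Fin p) ℝ} {L : RIdx n p → ℝ}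

theorem colsR_transpose_mul_colsR (hV : IsSpectralFrame X V L) :
    (colsR n V)ᵀ * colsR n V = 1 := by
  have h : Vᵀ * V = 1 := (Matrix.mem_orthogonalGroup_iff' (Fin p) ℝ).1 hV.orthogonal
  have h' := congrArg (fun M => M.submatrix (Subtype.val : RIdx n p → Fin p)
    (Subtype.val : RIdx n p → Fin p)) h
  simp only [Matrix.submatrix_one _ Subtype.val_injective] at h'
  rw [← h']
  rfl

theorem colsR_add_colsN (hV : IsSpectralFrame X V L) :
    colsR n V * (colsR n V)ᵀ + colsN n V * (colsN n V)ᵀ = 1 := by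
  have h : V * Vᵀ = 1 := (Matrix.mem_orthogonalGroup_iff (Fin p) ℝ).1 hV.orthogonal
  rw [← h]
  ext i j
  simp only [Matrix.add_apply, Matrix.mul_apply, colsR, colsN, Matrix.submatrix_apply,
    Matrix.transpose_apply, id]
  rw [← Finset.sum_subtype (Finset.univ.filter fun k : Fin p => (k : ℕ) < n) (by simp)
      (fun k => V i k * V j k),
    ← Finset.sum_subtype (Finset.univ.filter fun k : Fin p => n ≤ (k : ℕ)) (by simp)
      (fun k => V i k * V j k),
    ← Finset.sum_filter_add_sum_filter_not Finset.univ fun k : Fin p => (k : ℕ) < n]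
  simp only [not_lt]

theorem mul_colsN (hV : IsSpectralFrame X V L) : X * colsN n V = 0 := by
  ext i k
  have h : (colsN n V).col k ∈ LinearMap.ker X.mulVecLin :=
    hV.null ▸ Submodule.subset_span (Set.mem_range_self k)
  exact congrFun (LinearMap.mem_ker.1 h) i

theorem colsN_transpose_mul (hV : IsSpectralFrame X V L) : (colsN n V)ᵀ * Xᵀ = 0 := by
  rw [← Matrix.transpose_mul, hV.mul_colsN, Matrix.transpose_zero]

theorem transpose_mul_mul_colsR (hn : 0 < n) (hV : IsSpectralFrame X V L) :
    Xᵀ * (X * colsR n V) = (n : ℝ) • (colsR n V * Matrix.diagonal L) := by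
  have hn' : (n : ℝ) ≠ 0 := by positivity
  have h : gram X * colsR n V = colsR n V * Matrix.diagonal L := by
    ext i k
    have := congrFun (hV.eigen k) i
    rw [Matrix.mul_diagonal, mul_comm]
    exact this
  rw [← h, gram, Matrix.smul_mul, smul_smul, mul_one_div_cancel hn', one_smul, Matrix.mul_assoc]

end IsSpectralFrame

/-- The matrix `X V_R diag(L)⁻¹ V_Rᵀ`; `1 / n` times it is a left inverse of `Xᵀ`. -/
noncomputable def pinvT (X : Matrix (Fin n) (Fin p) ℝ) (V : Matrix (Fin p) (Fin p) ℝ) (L : RIdx n p → ℝ) :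
    Matrix (Fin n) (Fin p) ℝ :=
  X * colsR n V * Matrix.diagonal (fun k => (L k)⁻¹) * (colsR n V)ᵀ

namespace IsSpectralFrame

variable {X : Matrix (Fin n) (Fin p) ℝ} {V : Matrix (Fin p) (Fin p) ℝ} {L : RIdx n p → ℝ}

theorem diagonal_inv_mul (hV : IsSpectralFrame X V L) :
    Matrix.diagonal (fun k => (L k)⁻¹) * Matrix.diagonal L = 1 := by
  rw [Matrix.diagonal_mul_diagonal, ← Matrix.diagonal_one]
  exact congrArg _ (funext fun k => inv_mul_cancel₀ (hV.eigen_pos k).ne')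

/-- From `V_Rᵀ Xᵀ X V_R = n diag(L)` the matrix `X V_R` has an explicit left inverse. It is square,
because there are `n` positive eigenvalues, so the left inverse is also a right inverse. -/
theorem pinvT_mul_transpose (hn : 0 < n) (hnp : n ≤ p) (hV : IsSpectralFrame X V L) :
    pinvT X V L * Xᵀ = (n : ℝ) • (1 : Matrix (Fin n) (Fin n) ℝ) := by
  have hn' : (n : ℝ) ≠ 0 := by positivity
  have h : ((n : ℝ)⁻¹ • (Matrix.diagonal (fun k => (L k)⁻¹) * (colsR n V)ᵀ * Xᵀ)) *
      (X * colsR n V) = 1 := by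
    rw [Matrix.smul_mul, Matrix.mul_assoc, hV.transpose_mul_mul_colsR hn, Matrix.mul_smul,
      smul_smul, inv_mul_cancel₀ hn', one_smul, Matrix.mul_assoc, ← Matrix.mul_assoc _ (colsR n V),
      hV.colsR_transpose_mul_colsR, Matrix.one_mul, hV.diagonal_inv_mul]
  have h' := (Matrix.mul_eq_one_comm_of_card_eq _ _ _ (by rw [card_RIdx hnp, Fintype.card_fin])).1 h
  rw [← h', Matrix.mul_smul, smul_smul, mul_inv_cancel₀ hn', one_smul, pinvT]
  simp only [Matrix.mul_assoc]

theorem pinvT_mulVec_transpose (hn : 0 < n) (hnp : n ≤ p) (hV : IsSpectralFrame X V L)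
    (z : Fin n → ℝ) : pinvT X V L *ᵥ (Xᵀ *ᵥ z) = (n : ℝ) • z := by
  rw [Matrix.mulVec_mulVec, hV.pinvT_mul_transpose hn hnp, Matrix.smul_mulVec, Matrix.one_mulVec]

/-- `Xᵀ pinvT = n (1 - V_N V_Nᵀ)` is `n` times the orthogonal projection onto the row space of `X`,
which contains `v`. -/
theorem transpose_mulVec_pinvT (hn : 0 < n) (hV : IsSpectralFrame X V L) {v : Fin p → ℝ}
    (hv : (colsN n V)ᵀ *ᵥ v = 0) : Xᵀ *ᵥ (pinvT X V L *ᵥ v) = (n : ℝ) • v := by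
  have hD : Matrix.diagonal L * Matrix.diagonal (fun k => (L k)⁻¹) = 1 :=
    mul_eq_one_comm.1 hV.diagonal_inv_mul
  have h : Xᵀ * pinvT X V L = (n : ℝ) • (1 - colsN n V * (colsN n V)ᵀ) := by
    rw [← hV.colsR_add_colsN, add_sub_cancel_right, pinvT, ← Matrix.mul_assoc, ← Matrix.mul_assoc,
      hV.transpose_mul_mul_colsR hn, Matrix.smul_mul, Matrix.smul_mul, Matrix.mul_assoc (colsR n V),
      hD, Matrix.mul_one]
  rw [Matrix.mulVec_mulVec, h, Matrix.smul_mulVec, Matrix.sub_mulVec, ← Matrix.mulVec_mulVec, hv,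
    Matrix.mulVec_zero, Matrix.one_mulVec, sub_zero]

/-- `Σ (V_Rᵀ Xᵀ z / n)_k² / L_k = ‖z‖² / n`. -/
theorem sum_sq_div_eq (hn : 0 < n) (hnp : n ≤ p) (hV : IsSpectralFrame X V L) (z : Fin n → ℝ) :
    ∑ k, ((colsR n V)ᵀ *ᵥ ((1 / (n : ℝ)) • (Xᵀ *ᵥ z))) k ^ 2 / L k = (∑ i, z i ^ 2) / n := by
  have hn' : (n : ℝ) ≠ 0 := by positivity
  -- This form is evaluated twice: through the left inverse here, and in the eigenbasis in `h2`.
  have h : z ⬝ᵥ (pinvT X V L *ᵥ (Xᵀ *ᵥ z)) = n * ∑ i, z i ^ 2 := by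
    rw [hV.pinvT_mulVec_transpose hn hnp, dotProduct_smul, smul_eq_mul, dotProduct]
    simp only [sq]
  have h2 : z ⬝ᵥ (pinvT X V L *ᵥ (Xᵀ *ᵥ z)) = ∑ k, ((colsR n V)ᵀ *ᵥ (Xᵀ *ᵥ z)) k ^ 2 / L k := by
    rw [pinvT, ← Matrix.mulVec_mulVec, ← Matrix.mulVec_mulVec, Matrix.dotProduct_mulVec,
      ← Matrix.mulVec_transpose, Matrix.transpose_mul, ← Matrix.mulVec_mulVec, dotProduct]
    refine Finset.sum_congr rfl fun k _ => ?_
    rw [Matrix.mulVec_diagonal]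
    ring
  rw [h2] at h
  have h3 : ∀ k, ((colsR n V)ᵀ *ᵥ ((1 / (n : ℝ)) • (Xᵀ *ᵥ z))) k ^ 2 / L k =
      (1 / (n : ℝ)) ^ 2 * (((colsR n V)ᵀ *ᵥ (Xᵀ *ᵥ z)) k ^ 2 / L k) := by
    intro k
    rw [Matrix.mulVec_smul, Pi.smul_apply, smul_eq_mul]
    ring
  simp_rw [h3]
  rw [← Finset.mul_sum, h]
  field_simp

/-- Up to a constant, `densR` at `V_Rᵀ Xᵀ (y - m) / n` is the density of `N(m, sig² I)` at `y`. -/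
theorem exists_densR_eq (hn : 0 < n) (hnp : n ≤ p) (hV : IsSpectralFrame X V L) {sig : ℝ}
    (hsig : 0 < sig) (m : Fin n → ℝ) :
    ∃ C : ℝ, 0 < C ∧ ∀ y : Fin n → ℝ,
      densR L sig ((colsR n V)ᵀ *ᵥ ((1 / (n : ℝ)) • (Xᵀ *ᵥ (y - m)))) =
        C * ∏ i, gaussianPDFReal (m i) (Real.toNNReal (sig ^ 2)) (y i) := by
  have hn' : (0 : ℝ) < n := by positivity
  have hs2 : 0 < sig ^ 2 := by positivity
  set a : ℝ := ∏ k : RIdx n p, (√(2 * Real.pi * (sig ^ 2 * L k / n)))⁻¹ with ha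
  set b : ℝ := ∏ _i : Fin n, (√(2 * Real.pi * sig ^ 2))⁻¹ with hb
  have ha0 : 0 < a := Finset.prod_pos fun k _ => by
    have := hV.eigen_pos k
    have := Real.pi_pos
    positivity
  have hb0 : 0 < b := Finset.prod_pos fun k _ => by
    have := Real.pi_pos
    positivity
  -- The constant is the quotient of the two Gaussian normalizing factors; the exponents agree by
  -- `sum_sq_div_eq`.
  refine ⟨a / b, div_pos ha0 hb0, fun y => ?_⟩
  have hvk : ∀ k, ((Real.toNNReal (sig ^ 2 * L k / n) : NNReal) : ℝ) = sig ^ 2 * L k / n :=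
    fun k => Real.coe_toNNReal _ (by have := hV.eigen_pos k; positivity)
  simp only [densR, gaussianPDFReal, hvk, Real.coe_toNNReal _ hs2.le]
  rw [Finset.prod_mul_distrib, Finset.prod_mul_distrib, ← Real.exp_sum, ← Real.exp_sum, ← ha, ← hb,
    ← mul_assoc, div_mul_cancel₀ _ hb0.ne']
  congr 2
  have h := hV.sum_sq_div_eq hn hnp (y - m)
  have h1 : ∀ k : RIdx n p, -(((colsR n V)ᵀ *ᵥ ((1 / (n : ℝ)) • (Xᵀ *ᵥ (y - m)))) k - 0) ^ 2 /
      (2 * (sig ^ 2 * L k / n)) = -(n / (2 * sig ^ 2)) *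
        (((colsR n V)ᵀ *ᵥ ((1 / (n : ℝ)) • (Xᵀ *ᵥ (y - m)))) k ^ 2 / L k) := by
    intro k
    have := (hV.eigen_pos k).ne'
    field_simp
    ring
  simp_rw [h1]
  rw [← Finset.mul_sum, h, Finset.sum_div, Finset.mul_sum]
  refine Finset.sum_congr rfl fun i _ => ?_
  rw [Pi.sub_apply]
  field_simp

end IsSpectralFrame

/-! ### Vectors assembled from their blocks on `A` and on its complement -/

/-- The `p`-vector with blocks `θ.1` on `A` and `θ.2` on the complement of `A`. -/
def glue (A : Finset (Fin p)) : Theta A →ₗ[ℝ] (Fin p → ℝ) where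
  toFun θ j := if h : j ∈ A then θ.1 ⟨j, h⟩ else θ.2 ⟨j, h⟩
  map_add' θ θ' := by
    ext j
    by_cases h : j ∈ A <;> simp [h]
  map_smul' r θ := by
    ext j
    by_cases h : j ∈ A <;> simp [h]

@[simp]
theorem glue_apply_mem {A : Finset (Fin p)} (θ : Theta A) {j : Fin p} (h : j ∈ A) :
    glue A θ j = θ.1 ⟨j, h⟩ := dif_pos h

@[simp]
theorem glue_apply_notMem {A : Finset (Fin p)} (θ : Theta A) {j : Fin p} (h : j ∉ A) :
    glue A θ j = θ.2 ⟨j, h⟩ := dif_neg h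

theorem blockA_apply (V : Matrix (Fin p) (Fin p) ℝ) (w : Fin p → ℝ) (A : Finset (Fin p))
    (k : NIdx n p) (j : A) : blockA n V w A k j = V j k * w j :=
  Matrix.mul_diagonal _ (((colsN n V).submatrix (Subtype.val : A → Fin p) id)ᵀ) k j

theorem blockI_apply (V : Matrix (Fin p) (Fin p) ℝ) (w : Fin p → ℝ) (A : Finset (Fin p))
    (k : NIdx n p) (j : Inactive A) : blockI n V w A k j = V j k * w j :=
  Matrix.mul_diagonal _ (((colsN n V).submatrix (Subtype.val : Inactive A → Fin p) id)ᵀ) k j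

/-- The block equation says that `W s` is orthogonal to `null(X)`, which is what makes the KKT
equation solvable for a response. -/
theorem nullEq_iff {V : Matrix (Fin p) (Fin p) ℝ} {w : Fin p → ℝ} {A : Finset (Fin p)}
    (σ : A → ℝ) (s : Inactive A → ℝ) :
    NullEq n V w A σ s ↔ (colsN n V)ᵀ *ᵥ (Matrix.diagonal w *ᵥ glue A (σ, s)) = 0 := by
  have h : blockA n V w A *ᵥ σ + blockI n V w A *ᵥ s =
      (colsN n V)ᵀ *ᵥ (Matrix.diagonal w *ᵥ glue A (σ, s)) := by
    ext k
    simp only [Pi.add_apply, Matrix.mulVec, dotProduct, blockA_apply, blockI_apply,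
      Matrix.transpose_apply, colsN, Matrix.submatrix_apply, id, Matrix.diagonal_apply, ite_mul,
      zero_mul, Finset.sum_ite_eq, Finset.mem_univ, if_true]
    rw [← Fintype.sum_subtype_add_sum_subtype (fun j => j ∈ A)]
    congr 1
    · exact Finset.sum_congr (Finset.ext (by simp)) fun j _ => by rw [glue_apply_mem _ j.2, mul_assoc]
    · exact Finset.sum_congr (Finset.ext (by simp)) fun j _ => by rw [glue_apply_notMem _ j.2, mul_assoc]
  rw [NullEq, h]

/-! ### Columns in general position -/

theorem mulVec_eq_sum_col (X : Matrix (Fin n) (Fin p) ℝ) (v : Fin p → ℝ) :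
    X *ᵥ v = ∑ j, v j • X.col j := by
  ext i
  simp [Matrix.mulVec, dotProduct, Finset.sum_apply, mul_comm]

/-- General position concerns exactly `n` columns, so `A` is first enlarged to a set of size `n`. -/
theorem eq_zero_of_mulVec_glue_eq_zero (hnp : n ≤ p) {X : Matrix (Fin n) (Fin p) ℝ}
    (hX : ∀ J : Finset (Fin p), J.card = n → LinearIndependent ℝ (fun j : J => X.col j))
    {A : Finset (Fin p)} (hA : A.card ≤ n) {a : A → ℝ} (h : X *ᵥ glue A (a, 0) = 0) : a = 0 := by
  obtain ⟨J, hAJ, hJ⟩ := Finset.exists_superset_card_eq hA (by simpa using hnp)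
  have hJ0 := Fintype.linearIndependent_iff.1 (hX J hJ) (fun j => glue A (a, 0) j) (by
    rw [Finset.sum_coe_sort J fun j => glue A (a, 0) j • X.col j, ← h, mulVec_eq_sum_col]
    refine Finset.sum_subset (Finset.subset_univ _) fun j _ hj => ?_
    rw [glue_apply_notMem _ fun hjA => hj (hAJ hjA)]
    simp)
  ext j
  simpa using hJ0 ⟨j, hAJ j.2⟩

/-- The `n` independent columns span `ℝⁿ`, so `u` is orthogonal to itself. -/
theorem eq_zero_of_transpose_mulVec_eq_zero_on {X : Matrix (Fin n) (Fin p) ℝ}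
    {J : Finset (Fin p)} (hJ : J.card = n) (hX : LinearIndependent ℝ (fun j : J => X.col j))
    {u : Fin n → ℝ} (hu : ∀ j ∈ J, (Xᵀ *ᵥ u) j = 0) : u = 0 := by
  have hspan : Submodule.span ℝ (Set.range fun j : J => X.col j) = ⊤ :=
    hX.span_eq_top_of_card_eq_finrank' (by simp [hJ])
  rw [← dotProduct_self_eq_zero]
  have : u ∈ Submodule.span ℝ (Set.range fun j : J => X.col j) := hspan ▸ Submodule.mem_top
  refine Submodule.span_induction (p := fun v _ => v ⬝ᵥ u = 0) ?_ (zero_dotProduct u) ?_ ?_ this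
  · rintro _ ⟨j, rfl⟩
    exact hu j j.2
  · intro v v' _ _ h h'
    rw [add_dotProduct, h, h', add_zero]
  · intro r v _ h
    rw [smul_dotProduct, h, smul_zero]

/-! ### The KKT conditions -/

theorem gram_mulVec (X : Matrix (Fin n) (Fin p) ℝ) (b : Fin p → ℝ) :
    gram X *ᵥ b = (1 / (n : ℝ)) • (Xᵀ *ᵥ (X *ᵥ b)) := by
  rw [gram, Matrix.smul_mulVec, Matrix.mulVec_mulVec]

/-- The KKT conditions are sufficient for optimality. -/
theorem isLassoSolution_of_kkt {X : Matrix (Fin n) (Fin p) ℝ} {w : Fin p → ℝ} {lam : ℝ}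
    (hw : ∀ j, 0 < w j) (hlam : 0 < lam) {y : Fin n → ℝ} {b s : Fin p → ℝ}
    (h : (1 / (n : ℝ)) • (Xᵀ *ᵥ y) = gram X *ᵥ b + lam • (Matrix.diagonal w *ᵥ s))
    (hs : ∀ j, |s j| ≤ 1) (hsb : ∀ j, s j * b j = |b j|) : IsLassoSolution X w lam y b := by
  intro b'
  have hkkt : ∀ j, (1 / (n : ℝ)) * (Xᵀ *ᵥ (y - X *ᵥ b)) j = lam * (w j * s j) := by
    intro j
    have := congrFun h j
    rw [gram_mulVec] at this
    simp only [Pi.smul_apply, Pi.add_apply, smul_eq_mul, Matrix.mulVec_diagonal] at this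
    rw [Matrix.mulVec_sub, Pi.sub_apply, mul_sub, this]
    ring
  have hinner : (1 / (n : ℝ)) * ((y - X *ᵥ b) ⬝ᵥ (X *ᵥ (b' - b))) =
      lam * ∑ j, w j * (s j * b' j - |b j|) := by
    rw [Matrix.dotProduct_mulVec, ← Matrix.mulVec_transpose, dotProduct, Finset.mul_sum,
      Finset.mul_sum]
    refine Finset.sum_congr rfl fun j _ => ?_
    rw [← mul_assoc, hkkt, Pi.sub_apply, ← hsb]
    ring
  have hle : ∑ j, w j * (s j * b' j - |b j|) ≤ ∑ j, w j * |b' j| - ∑ j, w j * |b j| := by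
    rw [← Finset.sum_sub_distrib]
    refine Finset.sum_le_sum fun j _ => ?_
    rw [← mul_sub]
    refine mul_le_mul_of_nonneg_left (sub_le_sub_right ?_ _) (hw j).le
    calc s j * b' j ≤ |s j| * |b' j| := (le_abs_self _).trans (abs_mul _ _).le
      _ ≤ 1 * |b' j| := mul_le_mul_of_nonneg_right (hs j) (abs_nonneg _)
      _ = |b' j| := one_mul _
  have hquad : ∑ i, (y i - (X *ᵥ b') i) ^ 2 = ∑ i, (y i - (X *ᵥ b) i) ^ 2 -
      2 * ((y - X *ᵥ b) ⬝ᵥ (X *ᵥ (b' - b))) + ∑ i, (X *ᵥ (b' - b)) i ^ 2 := by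
    rw [dotProduct, Finset.mul_sum, ← Finset.sum_sub_distrib, ← Finset.sum_add_distrib]
    refine Finset.sum_congr rfl fun i _ => ?_
    rw [Matrix.mulVec_sub, Pi.sub_apply, Pi.sub_apply]
    ring
  have hsq : 0 ≤ 1 / (2 * (n : ℝ)) * ∑ i, (X *ᵥ (b' - b)) i ^ 2 :=
    mul_nonneg (by positivity) (Finset.sum_nonneg fun i _ => sq_nonneg _)
  have hle' := mul_le_mul_of_nonneg_left hle hlam.le
  rw [← hinner] at hle'
  have h2 : 1 / (n : ℝ) = 2 * (1 / (2 * (n : ℝ))) := by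
    -- Positivity of `n` is not available here; for `n = 0` both sides are `0` by the convention for
    -- division by zero.
    rcases eq_or_ne (n : ℝ) 0 with h0 | h0
    · simp [h0]
    · field_simp
  rw [h2] at hle'
  simp only [lassoObjective, hquad]
  nlinarith

/-- The active set of a unique lasso solution has at most `n` elements. -/
theorem card_activeSet_le (hn : 0 < n) {X : Matrix (Fin n) (Fin p) ℝ} {w : Fin p → ℝ}
    {lam : ℝ} (hw : ∀ j, 0 < w j) (hlam : 0 < lam) {y : Fin n → ℝ} {b : Fin p → ℝ}
    (hb : IsLassoSolution X w lam y b) (huniq : ∀ b', IsLassoSolution X w lam y b' → b = b') :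
    (activeSet b).card ≤ n := by
  by_contra! hcard
  set A := activeSet b with hA
  have hker := LinearMap.ker_ne_bot_of_finrank_lt
    (f := X.mulVecLin ∘ₗ glue A ∘ₗ LinearMap.inl ℝ (A → ℝ) (Inactive A → ℝ)) (by simpa using hcard)
  obtain ⟨a, ha, ha0⟩ := (Submodule.ne_bot_iff _).1 hker
  have hXa : X *ᵥ glue A (a, 0) = 0 := ha
  set d := glue A (a, 0) with hd
  set S := lassoSubgradient X w lam y b with hS
  have hev : ∀ᶠ t : ℝ in nhdsWithin 0 {0}ᶜ, ∀ j, S j * (b j + t * d j) = |b j + t * d j| := by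
    refine Filter.Eventually.filter_mono nhdsWithin_le_nhds (Filter.eventually_all.2 fun j => ?_)
    have hc : Filter.Tendsto (fun t : ℝ => b j + t * d j) (nhds 0) (nhds (b j)) := by
      have : Continuous fun t : ℝ => b j + t * d j := by fun_prop
      simpa using this.tendsto 0
    have hsub := lassoSubgradient_isSubgradient hn X w lam hw hlam y b hb j
    by_cases hj : j ∈ A
    · have hbj : b j ≠ 0 := (Finset.mem_filter.1 hj).2
      have hSj : S j = Real.sign (b j) := hsub.1 hbj
      rcases lt_or_gt_of_ne hbj with h | h
      · filter_upwards [hc.eventually (gt_mem_nhds h)] with t ht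
        rw [hSj, Real.sign_of_neg h, abs_of_neg ht]; ring
      · filter_upwards [hc.eventually (lt_mem_nhds h)] with t ht
        rw [hSj, Real.sign_of_pos h, abs_of_pos ht]; ring
    · have hbj : b j = 0 := by
        by_contra h
        exact hj (Finset.mem_filter.2 ⟨Finset.mem_univ _, h⟩)
      have hdj : d j = 0 := by rw [hd, glue_apply_notMem _ hj]; rfl
      simp [hbj, hdj]
  obtain ⟨t, ht, ht0⟩ := (hev.and self_mem_nhdsWithin).exists
  have hkkt := (lassoSubgradient_kkt X w lam hw hlam y b S).2 hS
  have hsol : IsLassoSolution X w lam y (b + t • d) := by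
    refine isLassoSolution_of_kkt hw hlam (s := S) ?_
      (fun j => (lassoSubgradient_isSubgradient hn X w lam hw hlam y b hb j).2) fun j => ?_
    · rw [hkkt, gram_mulVec X (b + t • d), Matrix.mulVec_add, Matrix.mulVec_smul, hXa, smul_zero,
        add_zero, gram_mulVec]
    · simpa using ht j
  have h0 : t • d = 0 := by simpa using huniq _ hsol
  have hd0 : d = 0 := (smul_eq_zero.1 h0).resolve_left ht0
  refine ha0 (funext fun j => ?_)
  have := congrFun hd0 j
  rwa [hd, glue_apply_mem _ j.2] at this

/-- The response whose KKT equation holds at the coefficients `b` and the subgradient `s`, when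
there is one. -/
noncomputable def response (X : Matrix (Fin n) (Fin p) ℝ) (V : Matrix (Fin p) (Fin p) ℝ)
    (L : RIdx n p → ℝ) (w : Fin p → ℝ) (lam : ℝ) (b s : Fin p → ℝ) : Fin n → ℝ :=
  pinvT X V L *ᵥ (gram X *ᵥ b + lam • (Matrix.diagonal w *ᵥ s))

namespace IsSpectralFrame

variable {X : Matrix (Fin n) (Fin p) ℝ} {V : Matrix (Fin p) (Fin p) ℝ} {L : RIdx n p → ℝ}

theorem colsN_transpose_mulVec_gram (hV : IsSpectralFrame X V L) (b : Fin p → ℝ) :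
    (colsN n V)ᵀ *ᵥ (gram X *ᵥ b) = 0 := by
  rw [gram_mulVec, Matrix.mulVec_smul, Matrix.mulVec_mulVec, hV.colsN_transpose_mul,
    Matrix.zero_mulVec, smul_zero]

theorem transpose_mulVec_response (hn : 0 < n) (hV : IsSpectralFrame X V L) {w : Fin p → ℝ}
    (lam : ℝ) (b : Fin p → ℝ) {s : Fin p → ℝ}
    (hs : (colsN n V)ᵀ *ᵥ (Matrix.diagonal w *ᵥ s) = 0) :
    (1 / (n : ℝ)) • (Xᵀ *ᵥ response X V L w lam b s) =
      gram X *ᵥ b + lam • (Matrix.diagonal w *ᵥ s) := by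
  have hn' : (n : ℝ) ≠ 0 := by positivity
  rw [response, hV.transpose_mulVec_pinvT hn, smul_smul, one_div_mul_cancel hn', one_smul]
  rw [Matrix.mulVec_add, hV.colsN_transpose_mulVec_gram, Matrix.mulVec_smul, hs, smul_zero,
    add_zero]

theorem response_eq_of_kkt (hn : 0 < n) (hnp : n ≤ p) (hV : IsSpectralFrame X V L)
    {w : Fin p → ℝ} {lam : ℝ} {y : Fin n → ℝ} {b s : Fin p → ℝ}
    (h : (1 / (n : ℝ)) • (Xᵀ *ᵥ y) = gram X *ᵥ b + lam • (Matrix.diagonal w *ᵥ s)) :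
    response X V L w lam b s = y := by
  have hn' : (n : ℝ) ≠ 0 := by positivity
  rw [response, ← h, Matrix.mulVec_smul, hV.pinvT_mulVec_transpose hn hnp, smul_smul,
    one_div_mul_cancel hn', one_smul]

theorem colsN_transpose_mulVec_of_kkt (hV : IsSpectralFrame X V L) {w : Fin p → ℝ} {lam : ℝ}
    (hlam : 0 < lam) {y : Fin n → ℝ} {b s : Fin p → ℝ}
    (h : (1 / (n : ℝ)) • (Xᵀ *ᵥ y) = gram X *ᵥ b + lam • (Matrix.diagonal w *ᵥ s)) :
    (colsN n V)ᵀ *ᵥ (Matrix.diagonal w *ᵥ s) = 0 := by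
  have h' := congrArg ((colsN n V)ᵀ *ᵥ ·) h
  simp only [Matrix.mulVec_add, Matrix.mulVec_smul, hV.colsN_transpose_mulVec_gram,
    Matrix.mulVec_mulVec, hV.colsN_transpose_mul, Matrix.zero_mulVec, smul_zero, zero_add] at h'
  rw [Matrix.mulVec_mulVec]
  exact (smul_eq_zero.1 h'.symm).resolve_left hlam.ne'

/-- A vector `v` with `V_Nᵀ v = 0` that is orthogonal to `n` independent columns vanishes. -/
theorem eq_zero_of_colsN_transpose_mulVec (hn : 0 < n) (hV : IsSpectralFrame X V L)
    {J : Finset (Fin p)} (hJ : J.card = n) (hX : LinearIndependent ℝ (fun j : J => X.col j))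
    {v : Fin p → ℝ} (hv : (colsN n V)ᵀ *ᵥ v = 0) (hvJ : ∀ j ∈ J, v j = 0) : v = 0 := by
  have hn' : (n : ℝ) ≠ 0 := by positivity
  have h := hV.transpose_mulVec_pinvT hn hv
  have h0 := eq_zero_of_transpose_mulVec_eq_zero_on hJ hX (u := pinvT X V L *ᵥ v) fun j hj => by
    rw [h, Pi.smul_apply, hvJ j hj, smul_zero]
  rw [h0, Matrix.mulVec_zero] at h
  exact (smul_eq_zero.1 h.symm).resolve_left hn'

end IsSpectralFrame

/-! ### Affine parameterizations of the solutions of the null-space equation -/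

/-- `t ↦ c σ + M t` parameterizes bijectively the solutions of the null-space equation with sign
vector `σ`. -/
structure IsNullParam (n : ℕ) {p : ℕ} (V : Matrix (Fin p) (Fin p) ℝ) (w : Fin p → ℝ)
    (A : Finset (Fin p)) {K : Type} (c : (A → ℝ) → (Inactive A → ℝ))
    (M : (K → ℝ) →ₗ[ℝ] (Inactive A → ℝ)) : Prop where
  injective : Function.Injective M
  range_eq : LinearMap.range M = LinearMap.ker (blockI n V w A).mulVecLin
  particular : ∀ σ : A → ℝ, (∀ j, σ j = 1 ∨ σ j = -1) → NullEq n V w A σ (c σ)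

/-- The parameterization `(b_A, t) ↦ (b_A, c (sgn b_A) + M t)`. -/
noncomputable def nullParam {A : Finset (Fin p)} {K : Type} (c : (A → ℝ) → (Inactive A → ℝ))
    (M : (K → ℝ) →ₗ[ℝ] (Inactive A → ℝ)) (x : (A → ℝ) × (K → ℝ)) : Theta A :=
  (x.1, c (sgn x.1) + M x.2)

namespace IsNullParam

variable {V : Matrix (Fin p) (Fin p) ℝ} {w : Fin p → ℝ} {A : Finset (Fin p)} {K : Type}
  {c : (A → ℝ) → (Inactive A → ℝ)} {M : (K → ℝ) →ₗ[ℝ] (Inactive A → ℝ)}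

theorem blockI_mulVec (hM : IsNullParam n V w A c M) (t : K → ℝ) : blockI n V w A *ᵥ M t = 0 := by
  have h : M t ∈ LinearMap.ker (blockI n V w A).mulVecLin := hM.range_eq ▸ ⟨t, rfl⟩
  exact h

theorem nullEq (hM : IsNullParam n V w A c M) {σ : A → ℝ} (hσ : ∀ j, σ j = 1 ∨ σ j = -1)
    (t : K → ℝ) : NullEq n V w A σ (c σ + M t) := by
  rw [NullEq, Matrix.mulVec_add, hM.blockI_mulVec, add_zero]
  exact hM.particular σ hσ

theorem exists_of_nullEq (hM : IsNullParam n V w A c M) {σ : A → ℝ}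
    (hσ : ∀ j, σ j = 1 ∨ σ j = -1) {s : Inactive A → ℝ} (hs : NullEq n V w A σ s) :
    ∃ t, s = c σ + M t := by
  have h : s - c σ ∈ LinearMap.range M := by
    rw [hM.range_eq, LinearMap.mem_ker, Matrix.mulVecLin_apply, Matrix.mulVec_sub, sub_eq_zero]
    exact add_left_cancel (hs.trans (hM.particular σ hσ).symm)
  obtain ⟨t, ht⟩ := h
  exact ⟨t, by rw [ht]; abel⟩

end IsNullParam

/-- The linear part of the map from parameters to responses. -/
noncomputable def responseLin (X : Matrix (Fin n) (Fin p) ℝ) (V : Matrix (Fin p) (Fin p) ℝ)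
    (L : RIdx n p → ℝ) (w : Fin p → ℝ) (lam : ℝ) {A : Finset (Fin p)} {K : Type}
    (M : (K → ℝ) →ₗ[ℝ] (Inactive A → ℝ)) : ((A → ℝ) × (K → ℝ)) →ₗ[ℝ] (Fin n → ℝ) :=
  (pinvT X V L).mulVecLin ∘ₗ
    ((gram X).mulVecLin ∘ₗ glue A ∘ₗ LinearMap.inl ℝ _ _ ∘ₗ LinearMap.fst ℝ _ _ +
      lam • ((Matrix.diagonal w).mulVecLin ∘ₗ glue A ∘ₗ LinearMap.inr ℝ _ _ ∘ₗ M ∘ₗ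
        LinearMap.snd ℝ _ _))

/-- The response with the parameters `x` and the sign vector `σ`. -/
noncomputable def signResponse (X : Matrix (Fin n) (Fin p) ℝ) (V : Matrix (Fin p) (Fin p) ℝ)
    (L : RIdx n p → ℝ) (w : Fin p → ℝ) (lam : ℝ) {A : Finset (Fin p)} {K : Type}
    (c : (A → ℝ) → (Inactive A → ℝ)) (M : (K → ℝ) →ₗ[ℝ] (Inactive A → ℝ)) (σ : A → ℝ)
    (x : (A → ℝ) × (K → ℝ)) : Fin n → ℝ :=
  response X V L w lam (glue A (x.1, 0)) (glue A (σ, c σ + M x.2))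

/-! ### Correspondence between feasible parameters and responses -/

section Bijection

variable {X : Matrix (Fin n) (Fin p) ℝ} {V : Matrix (Fin p) (Fin p) ℝ} {L : RIdx n p → ℝ}
  {w : Fin p → ℝ} {lam : ℝ} {A : Finset (Fin p)} {K : Type}
  {c : (A → ℝ) → (Inactive A → ℝ)} {M : (K → ℝ) →ₗ[ℝ] (Inactive A → ℝ)}

theorem responseLin_apply (x : (A → ℝ) × (K → ℝ)) :
    responseLin X V L w lam M x = response X V L w lam (glue A (x.1, 0)) (glue A (0, M x.2)) := rfl

/-- The sign vector enters only through a translation, so the Jacobian is the same for all signs. -/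
theorem signResponse_eq (σ : A → ℝ) (x : (A → ℝ) × (K → ℝ)) :
    signResponse X V L w lam c M σ x =
      responseLin X V L w lam M x + response X V L w lam 0 (glue A (σ, c σ)) := by
  have h : glue A (σ, c σ + M x.2) = glue A (0, M x.2) + glue A (σ, c σ) := by
    rw [← map_add, Prod.mk_add_mk, zero_add, add_comm]
  rw [signResponse, responseLin_apply, h]
  simp only [response, Matrix.mulVec_add, smul_add, Matrix.mulVec_zero, zero_add]
  abel

theorem responseLin_injective (hn : 0 < n) (hnp : n ≤ p)
    (hX : ∀ J : Finset (Fin p), J.card = n → LinearIndependent ℝ (fun j : J => X.col j))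
    (hw : ∀ j, 0 < w j) (hlam : 0 < lam) (hV : IsSpectralFrame X V L) (hA : A.card ≤ n)
    (hM : IsNullParam n V w A c M) : Function.Injective (responseLin X V L w lam M) := by
  rw [injective_iff_map_eq_zero]
  rintro ⟨a, t⟩ hx
  rw [responseLin_apply] at hx
  have hn0 : (n : ℝ) ≠ 0 := by positivity
  have hnull : (colsN n V)ᵀ *ᵥ (Matrix.diagonal w *ᵥ glue A (0, M t)) = 0 := by
    rw [← nullEq_iff, NullEq, Matrix.mulVec_zero, zero_add, hM.blockI_mulVec]
  have hkkt := hV.transpose_mulVec_response hn lam (glue A (a, 0)) hnull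
  rw [hx, Matrix.mulVec_zero, smul_zero] at hkkt
  -- Pair the homogeneous KKT equation with the coefficient vector: the subgradient part lives off
  -- `A` and drops out, leaving `‖X b‖² / n = 0`.
  have hdot : glue A (a, 0) ⬝ᵥ (gram X *ᵥ glue A (a, 0)) = 0 := by
    have h0 := congrArg (glue A (a, 0) ⬝ᵥ ·) hkkt
    have h1 : glue A (a, 0) ⬝ᵥ (Matrix.diagonal w *ᵥ glue A (0, M t)) = 0 := by
      refine Finset.sum_eq_zero fun j _ => ?_
      rw [Matrix.mulVec_diagonal]
      by_cases h : j ∈ A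
      · simp [h]
      · simp [h]
    simp only [dotProduct_zero, dotProduct_add, dotProduct_smul, h1, smul_zero, add_zero] at h0
    exact h0.symm
  have ha : a = 0 := by
    refine eq_zero_of_mulVec_glue_eq_zero hnp hX hA ?_
    rw [gram_mulVec, dotProduct_smul, Matrix.dotProduct_mulVec, Matrix.vecMul_transpose,
      smul_eq_mul, mul_eq_zero] at hdot
    exact dotProduct_self_eq_zero.1 (hdot.resolve_left (one_div_ne_zero hn0))
  have hz : glue A (a, 0) = 0 := by
    rw [ha]
    exact map_zero (glue A)
  rw [hz, Matrix.mulVec_zero, zero_add] at hkkt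
  have ht : M t = 0 := by
    ext j
    have h1 := congrFun ((smul_eq_zero.1 hkkt.symm).resolve_left hlam.ne') j
    rw [Matrix.mulVec_diagonal, glue_apply_notMem _ j.2] at h1
    exact (mul_eq_zero.1 h1).resolve_left (hw j).ne'
  rw [ha, hM.injective (ht.trans (map_zero M).symm)]
  rfl

theorem transpose_mulVec_signResponse (hn : 0 < n) (hV : IsSpectralFrame X V L)
    (hM : IsNullParam n V w A c M) {σ : A → ℝ} (hσ : ∀ j, σ j = 1 ∨ σ j = -1)
    (x : (A → ℝ) × (K → ℝ)) :
    (1 / (n : ℝ)) • (Xᵀ *ᵥ signResponse X V L w lam c M σ x) = gram X *ᵥ glue A (x.1, 0) +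
      lam • (Matrix.diagonal w *ᵥ glue A (σ, c σ + M x.2)) :=
  hV.transpose_mulVec_response hn lam _ ((nullEq_iff _ _).1 (hM.nullEq hσ x.2))

/-- This puts the argument of `f_R` into the form treated by `exists_densR_eq`. -/
theorem Hmap_nullParam (hn : 0 < n) (hV : IsSpectralFrame X V L)
    (hM : IsNullParam n V w A c M) {σ : A → ℝ} (hσ : ∀ j, σ j = 1 ∨ σ j = -1)
    {x : (A → ℝ) × (K → ℝ)} (hx : sgn x.1 = σ) (mu0 : Fin n → ℝ) :
    Hmap X w lam mu0 A (nullParam c M x) =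
      (1 / (n : ℝ)) • (Xᵀ *ᵥ (signResponse X V L w lam c M σ x - mu0)) := by
  rw [Matrix.mulVec_sub, smul_sub, transpose_mulVec_signResponse hn hV hM hσ, ← hx]
  rfl

variable {βhat : (Fin n → ℝ) → (Fin p → ℝ)}

/-- The parameters with signs `σ` that satisfy the constraints correspond to the responses for
which the lasso has active set `A` and signs `σ`. -/
theorem restrictTheta_signResponse (hn : 0 < n) (hw : ∀ j, 0 < w j) (hlam : 0 < lam)
    (huniq : ∀ y b b', IsLassoSolution X w lam y b → IsLassoSolution X w lam y b' → b = b')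
    (hβ : ∀ y, IsLassoSolution X w lam y (βhat y)) (hV : IsSpectralFrame X V L)
    (hM : IsNullParam n V w A c M) {σ : A → ℝ} (hσ : ∀ j, σ j = 1 ∨ σ j = -1)
    {x : (A → ℝ) × (K → ℝ)} (hx : sgn x.1 = σ) (hfeas : nullParam c M x ∈ feasible n V w A) :
    activeSet (βhat (signResponse X V L w lam c M σ x)) = A ∧
      restrictTheta A (βhat (signResponse X V L w lam c M σ x))
        (lassoSubgradient X w lam (signResponse X V L w lam c M σ x)
          (βhat (signResponse X V L w lam c M σ x))) = nullParam c M x := by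
  have hkkt := transpose_mulVec_signResponse (lam := lam) hn hV hM hσ x
  set y := signResponse X V L w lam c M σ x
  have hx0 : ∀ j, x.1 j ≠ 0 := fun j h => by
    have h1 : σ j = 0 := by rw [← hx, sgn, h, Real.sign_zero]
    rcases hσ j with h2 | h2 <;> rw [h2] at h1 <;> norm_num at h1
  have hbound : ‖c σ + M x.2‖ ≤ 1 := hx ▸ hfeas.2
  -- The parameters satisfy KKT, which suffices for optimality; uniqueness identifies the minimizer.
  have hsol : βhat y = glue A (x.1, 0) := by
    refine huniq y _ _ (hβ y) (isLassoSolution_of_kkt hw hlam hkkt (fun j => ?_) fun j => ?_)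
    · by_cases h : j ∈ A
      · rw [glue_apply_mem _ h]
        rcases hσ ⟨j, h⟩ with h2 | h2 <;> simp [h2]
      · rw [glue_apply_notMem _ h, ← Real.norm_eq_abs]
        exact (norm_le_pi_norm _ _).trans hbound
    · by_cases h : j ∈ A
      · rw [glue_apply_mem _ h, glue_apply_mem _ h, ← hx]
        rcases lt_or_gt_of_ne (hx0 ⟨j, h⟩) with h2 | h2
        · simp [sgn, Real.sign_of_neg h2, abs_of_neg h2]
        · simp [sgn, Real.sign_of_pos h2, abs_of_pos h2]
      · simp [glue_apply_notMem _ h]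
  have hS : glue A (σ, c σ + M x.2) = lassoSubgradient X w lam y (βhat y) := by
    rw [← lassoSubgradient_kkt X w lam hw hlam, hsol, hkkt]
  rw [← hS, hsol]
  constructor
  · ext j
    rw [activeSet, Finset.mem_filter]
    by_cases h : j ∈ A
    · simp [h, hx0 ⟨j, h⟩]
    · simp [h]
  · refine Prod.ext (funext fun j => ?_) (funext fun j => ?_)
    · exact glue_apply_mem _ j.2
    · rw [nullParam, hx]
      exact glue_apply_notMem _ j.2

theorem sgn_eq_one_or {A : Finset (Fin p)} {b : Fin p → ℝ} (hb : activeSet b = A) (j : A) :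
    Real.sign (b j) = 1 ∨ Real.sign (b j) = -1 := by
  have hj : (j : Fin p) ∈ activeSet b := hb ▸ j.2
  exact (Real.sign_apply_eq_of_ne_zero _ (Finset.mem_filter.1 hj).2).symm

/-- Necessity of KKT: the actual coefficients and subgradient at `y` provide the parameters. -/
theorem exists_signResponse_eq (hn : 0 < n) (hnp : n ≤ p) (hw : ∀ j, 0 < w j) (hlam : 0 < lam)
    (hβ : ∀ y, IsLassoSolution X w lam y (βhat y)) (hV : IsSpectralFrame X V L)
    (hM : IsNullParam n V w A c M) {σ : A → ℝ} {y : Fin n → ℝ} (hy : activeSet (βhat y) = A)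
    (hσ : sgn (fun j : A => βhat y j) = σ) :
    ∃ x, sgn x.1 = σ ∧ nullParam c M x ∈ feasible n V w A ∧
      signResponse X V L w lam c M σ x = y := by
  have hσ1 : ∀ j, σ j = 1 ∨ σ j = -1 := fun j => hσ ▸ sgn_eq_one_or hy j
  set S := lassoSubgradient X w lam y (βhat y) with hS
  have hkkt := (lassoSubgradient_kkt X w lam hw hlam y (βhat y) S).2 hS
  have hsub := lassoSubgradient_isSubgradient hn X w lam hw hlam y (βhat y) (hβ y)
  have hglueS : glue A (σ, fun j => S j) = S := by
    ext j
    by_cases h : j ∈ A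
    · rw [glue_apply_mem _ h, ← hσ]
      exact ((hsub j).1 (Finset.mem_filter.1 (hy.symm ▸ h : j ∈ activeSet (βhat y))).2).symm
    · rw [glue_apply_notMem _ h]
  have hglueb : glue A (fun j => βhat y j, 0) = βhat y := by
    ext j
    by_cases h : j ∈ A
    · rw [glue_apply_mem _ h]
    · rw [glue_apply_notMem _ h]
      by_contra h0
      exact h (hy ▸ Finset.mem_filter.2 ⟨Finset.mem_univ _, Ne.symm h0⟩)
  have hnull : NullEq n V w A σ (fun j => S j) := by
    rw [nullEq_iff, hglueS]
    exact hV.colsN_transpose_mulVec_of_kkt hlam hkkt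
  obtain ⟨t, ht⟩ := hM.exists_of_nullEq hσ1 hnull
  refine ⟨(fun j => βhat y j, t), hσ, ?_, ?_⟩
  · rw [nullParam, hσ]
    simp only
    rw [← ht]
    refine ⟨?_, (pi_norm_le_iff_of_nonneg zero_le_one).2 fun j => ?_⟩
    · rwa [hσ]
    · exact (hsub j).2
  · rw [signResponse]
    simp only
    rw [← ht, hglueS, hglueb]
    exact hV.response_eq_of_kkt hn hnp hkkt

end Bijection

/-! ### Measure-theoretic preliminaries -/

theorem measurable_sgn {ι : Type*} [Finite ι] : Measurable (sgn : (ι → ℝ) → ι → ℝ) := by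
  refine measurable_pi_lambda _ fun j => ?_
  have h : Measurable Real.sign := by
    unfold Real.sign
    exact Measurable.ite measurableSet_Iio measurable_const
      (Measurable.ite measurableSet_Ioi measurable_const measurable_const)
  exact h.comp (measurable_pi_apply j)

/-- Every function of the sign vector is measurable. -/
theorem measurable_comp_sgn {ι β : Type*} [Finite ι] [MeasurableSpace β] (c : (ι → ℝ) → β) :
    Measurable fun a : ι → ℝ => c (sgn a) := by
  -- Only finitely many sign vectors occur, so an arbitrary choice of particular solutions `c` is
  -- harmless for measurability.
  have hfin : (Set.range (sgn : (ι → ℝ) → ι → ℝ)).Finite := by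
    refine (Set.Finite.pi' fun _ : ι => Set.toFinite {(-1 : ℝ), 0, 1}).subset ?_
    rintro _ ⟨a, rfl⟩ j
    exact Real.sign_apply_eq (a j)
  intro S _
  have h : (fun a : ι → ℝ => c (sgn a)) ⁻¹' S = sgn ⁻¹' (c ⁻¹' S ∩ Set.range sgn) := by
    ext a
    simp
  rw [h]
  exact measurable_sgn (hfin.subset Set.inter_subset_right).measurableSet

theorem measurableSet_feasible (V : Matrix (Fin p) (Fin p) ℝ) (w : Fin p → ℝ)
    (A : Finset (Fin p)) : MeasurableSet (feasible n V w A) := by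
  have h1 : Measurable fun θ : Theta A => blockA n V w A *ᵥ sgn θ.1 :=
    (Continuous.measurable (by fun_prop : Continuous fun σ : A → ℝ => blockA n V w A *ᵥ σ)).comp
      (measurable_sgn.comp measurable_fst)
  have h2 : Measurable fun θ : Theta A => blockI n V w A *ᵥ θ.2 :=
    (Continuous.measurable
      (by fun_prop : Continuous fun s : Inactive A → ℝ => blockI n V w A *ᵥ s)).comp measurable_snd
  exact (measurableSet_eq_fun (h1.add h2) measurable_const).inter
    (measurableSet_le measurable_snd.norm measurable_const)

theorem measurable_nullParam {A : Finset (Fin p)} {K : Type} [Fintype K]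
    (c : (A → ℝ) → (Inactive A → ℝ)) (M : (K → ℝ) →ₗ[ℝ] (Inactive A → ℝ)) :
    Measurable (nullParam c M) :=
  measurable_fst.prodMk (((measurable_comp_sgn c).comp measurable_fst).add
    (M.continuous_of_finiteDimensional.measurable.comp measurable_snd))

/-- A finite union of hyperplanes, each the kernel of a nonzero coordinate functional. -/
theorem volume_exists_eq_zero {ι K : Type*} [Fintype ι] [Fintype K] :
    (volume : Measure ((ι → ℝ) × (K → ℝ))) {x | ∃ j, x.1 j = 0} = 0 := by
  rw [Set.ofPred_exists]
  refine measure_iUnion_null fun j => ?_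
  set f : ((ι → ℝ) × (K → ℝ)) →ₗ[ℝ] ℝ := LinearMap.proj j ∘ₗ LinearMap.fst ℝ _ _
  have hf : LinearMap.ker f ≠ ⊤ := fun h => by
    have h1 : f (fun _ => 1, 0) = 0 := by
      rw [LinearMap.ker_eq_top.1 h]; rfl
    exact one_ne_zero h1
  have : (volume : Measure ((ι → ℝ) × (K → ℝ))).IsAddHaarMeasure :=
    Measure.prod.instIsAddHaarMeasure _ _
  exact Measure.addHaar_submodule volume (LinearMap.ker f) hf

/-- The total mass of `ν` is `κ P(Y ∈ E)`, so normalizing cancels `κ` and leaves the conditional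
law. Measurability of `T` is needed only on `E`. -/
theorem IsNormalizationOf.of_hasLaw {Ω α β : Type*} [MeasurableSpace Ω] [MeasurableSpace α]
    [MeasurableSpace β] {P : Measure Ω} [IsProbabilityMeasure P] {μ : Measure α} {Y : Ω → α}
    (hY : HasLaw Y μ P) {E : Set α} (hE : MeasurableSet E) {T : α → β}
    (hT : AEMeasurable T (μ.restrict E)) (hPE : P (Y ⁻¹' E) ≠ 0) {κ : ENNReal} (hκ0 : κ ≠ 0)
    (hκ : κ ≠ ⊤) {ν : Measure β} (hν : ν = κ • (μ.restrict E).map T) :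
    IsNormalizationOf ((ProbabilityTheory.cond P (Y ⁻¹' E)).map fun ω => T (Y ω)) ν := by
  have hYE : μ.restrict E = (P.restrict (Y ⁻¹' E)).map Y := by
    rw [← hY.map_eq, Measure.restrict_map_of_aemeasurable hY.aemeasurable hE]
  have hmap : (μ.restrict E).map T = (P.restrict (Y ⁻¹' E)).map fun ω => T (Y ω) := by
    rw [hYE] at hT ⊢
    exact AEMeasurable.map_map_of_aemeasurable hT hY.aemeasurable.restrict
  have huniv : ν Set.univ = κ * P (Y ⁻¹' E) := by
    rw [hν, Measure.smul_apply, Measure.map_apply_of_aemeasurable hT MeasurableSet.univ,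
      Set.preimage_univ, hYE, Measure.map_apply_of_aemeasurable hY.aemeasurable.restrict
      MeasurableSet.univ, Set.preimage_univ, Measure.restrict_apply_univ, smul_eq_mul]
  refine ⟨?_, ?_, ?_⟩
  · rw [huniv]
    exact mul_ne_zero hκ0 hPE
  · rw [huniv]
    exact ENNReal.mul_ne_top hκ (measure_ne_top _ _)
  · rw [huniv, hν, smul_smul, hmap, ProbabilityTheory.cond, Measure.map_smul,
      ENNReal.mul_inv (Or.inl hκ0) (Or.inl hκ), mul_comm κ⁻¹, mul_assoc,
      ENNReal.inv_mul_cancel hκ0 hκ, mul_one]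

/-! ### Sign vectors as a finite index type -/

/-- The sign vector encoded by `τ`. -/
def signOf {ι : Type*} (τ : ι → Bool) : ι → ℝ := fun j => if τ j then 1 else -1

theorem signOf_eq_or {ι : Type*} (τ : ι → Bool) (j : ι) : signOf τ j = 1 ∨ signOf τ j = -1 := by
  by_cases h : τ j <;> simp [signOf, h]

theorem signOf_injective {ι : Type*} : Function.Injective (signOf : (ι → Bool) → ι → ℝ) := by
  intro τ τ' h
  ext j
  have := congrFun h j
  simp only [signOf] at this
  cases h1 : τ j <;> cases h2 : τ' j <;> simp [h1, h2] at this ⊢ <;> norm_num at this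

theorem exists_signOf_eq {ι : Type*} {σ : ι → ℝ} (hσ : ∀ j, σ j = 1 ∨ σ j = -1) :
    ∃ τ, signOf τ = σ := by
  classical
  refine ⟨fun j => decide (σ j = 1), funext fun j => ?_⟩
  rcases hσ j with h | h
  · simp [signOf, h]
  · have : (-1 : ℝ) ≠ 1 := by norm_num
    simp [signOf, h, this]

/-- `(β̂_A, S_A^c)` as a function of the response. -/
noncomputable def lassoTheta (X : Matrix (Fin n) (Fin p) ℝ) (w : Fin p → ℝ) (lam : ℝ)
    (A : Finset (Fin p)) (βhat : (Fin n → ℝ) → (Fin p → ℝ)) (y : Fin n → ℝ) : Theta A :=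
  restrictTheta A (βhat y) (lassoSubgradient X w lam y (βhat y))

/-! ### Change of variables, one sign vector at a time -/

section ChangeOfVariables

variable {X : Matrix (Fin n) (Fin p) ℝ} {V : Matrix (Fin p) (Fin p) ℝ} {L : RIdx n p → ℝ}
  {w : Fin p → ℝ} {lam : ℝ} {A : Finset (Fin p)} {K : Type}
  {c : (A → ℝ) → (Inactive A → ℝ)} {M : (K → ℝ) →ₗ[ℝ] (Inactive A → ℝ)}
  {βhat : (Fin n → ℝ) → (Fin p → ℝ)}

/-- For each sign vector the map from parameters to responses is a bijection that multiplies
Lebesgue measure by a factor which does not depend on the sign vector. -/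
theorem exists_measurableEquiv_signResponse [Fintype K] (hn : 0 < n) (hnp : n ≤ p)
    (hX : ∀ J : Finset (Fin p), J.card = n → LinearIndependent ℝ (fun j : J => X.col j))
    (hw : ∀ j, 0 < w j) (hlam : 0 < lam) (hV : IsSpectralFrame X V L)
    (hAK : A.card + Fintype.card K = n) (hM : IsNullParam n V w A c M) :
    ∃ κ : ENNReal, κ ≠ 0 ∧ κ ≠ ⊤ ∧ ∀ σ : A → ℝ,
      ∃ e : ((A → ℝ) × (K → ℝ)) ≃ᵐ (Fin n → ℝ), (⇑e = signResponse X V L w lam c M σ) ∧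
        (volume : Measure ((A → ℝ) × (K → ℝ))).map e = κ • volume := by
  have hinj := responseLin_injective hn hnp hX hw hlam hV (by omega) hM
  have hfr : Module.finrank ℝ ((A → ℝ) × (K → ℝ)) = Module.finrank ℝ (Fin n → ℝ) := by
    simpa using hAK
  set ℓ := responseLin X V L w lam M with hℓ
  let e₀ : ((A → ℝ) × (K → ℝ)) ≃L[ℝ] (Fin n → ℝ) := (LinearEquiv.ofBijective ℓ
    ⟨hinj, (LinearMap.injective_iff_surjective_of_finrank_eq_finrank hfr).1
      hinj⟩).toContinuousLinearEquiv
  have : (volume : Measure ((A → ℝ) × (K → ℝ))).IsAddHaarMeasure :=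
    Measure.prod.instIsAddHaarMeasure _ _
  have hHaar : ((volume : Measure ((A → ℝ) × (K → ℝ))).map e₀).IsAddHaarMeasure :=
    e₀.isAddHaarMeasure_map volume
  -- The factor comes from the linear part alone, hence is chosen before `σ`; the translation by `v`
  -- preserves Lebesgue measure.
  refine ⟨Measure.addHaarScalarFactor ((volume : Measure ((A → ℝ) × (K → ℝ))).map e₀) volume,
    ?_, ENNReal.coe_ne_top, fun σ => ?_⟩
  · exact_mod_cast (Measure.addHaarScalarFactor_pos_of_isAddHaarMeasure _ _).ne'
  set v := response X V L w lam 0 (glue A (σ, c σ))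
  have he : ⇑(e₀.toHomeomorph.toMeasurableEquiv.trans (MeasurableEquiv.addRight v)) =
      signResponse X V L w lam c M σ := by
    ext1 x
    rw [signResponse_eq]
    rfl
  refine ⟨_, he, ?_⟩
  have hcomp : ⇑(e₀.toHomeomorph.toMeasurableEquiv.trans (MeasurableEquiv.addRight v)) =
      (fun z => z + v) ∘ e₀ := rfl
  rw [hcomp, ← Measure.map_map (by fun_prop) e₀.continuous.measurable, map_add_right_eq_self]
  exact Measure.isAddLeftInvariant_eq_smul _ _

theorem preimage_signResponse (hn : 0 < n) (hnp : n ≤ p)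
    (hw : ∀ j, 0 < w j) (hlam : 0 < lam)
    (huniq : ∀ y b b', IsLassoSolution X w lam y b → IsLassoSolution X w lam y b' → b = b')
    (hβ : ∀ y, IsLassoSolution X w lam y (βhat y)) (hV : IsSpectralFrame X V L)
    (hM : IsNullParam n V w A c M) {σ : A → ℝ} (hσ : ∀ j, σ j = 1 ∨ σ j = -1)
    (hinj : Function.Injective (signResponse X V L w lam c M σ)) (S : Set (Theta A)) :
    signResponse X V L w lam c M σ ⁻¹' {y | activeSet (βhat y) = A ∧
      sgn (lassoTheta X w lam A βhat y).1 = σ ∧ lassoTheta X w lam A βhat y ∈ S} =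
    {x | sgn x.1 = σ ∧ nullParam c M x ∈ feasible n V w A ∧ nullParam c M x ∈ S} := by
  ext x
  constructor
  · rintro ⟨hA, hs, hS⟩
    obtain ⟨x', hx', hfeas, hxx⟩ := exists_signResponse_eq hn hnp hw hlam hβ hV hM hA hs
    -- The parameters recovered from KKT have the same response as `x`, so injectivity makes them
    -- equal to `x`.
    rw [hinj hxx] at hx' hfeas
    have h := (restrictTheta_signResponse hn hw hlam huniq hβ hV hM hσ hx' hfeas).2
    exact ⟨hx', hfeas, h ▸ hS⟩
  · rintro ⟨hx, hfeas, hS⟩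
    have h := restrictTheta_signResponse hn hw hlam huniq hβ hV hM hσ hx hfeas
    have h2 : lassoTheta X w lam A βhat (signResponse X V L w lam c M σ x) = nullParam c M x := h.2
    refine ⟨h.1, ?_, ?_⟩
    · rw [h2]; exact hx
    · rw [h2]; exact hS

theorem activeSet_inter_preimage_eq_iUnion (S : Set (Theta A)) :
    {y | activeSet (βhat y) = A} ∩ lassoTheta X w lam A βhat ⁻¹' S =
      ⋃ τ : A → Bool, {y | activeSet (βhat y) = A ∧
        sgn (lassoTheta X w lam A βhat y).1 = signOf τ ∧ lassoTheta X w lam A βhat y ∈ S} := by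
  ext y
  simp only [Set.mem_iUnion, Set.mem_inter_iff, Set.mem_ofPred_eq, Set.mem_preimage]
  constructor
  · rintro ⟨hA, hS⟩
    obtain ⟨τ, hτ⟩ := exists_signOf_eq (σ := sgn (lassoTheta X w lam A βhat y).1)
      fun j => sgn_eq_one_or hA j
    exact ⟨τ, hA, hτ.symm, hS⟩
  · rintro ⟨τ, hA, -, hS⟩
    exact ⟨hA, hS⟩

theorem measurableSet_nullParam [Fintype K] (σ : A → ℝ) {S : Set (Theta A)} (hS : MeasurableSet S) :
    MeasurableSet
      {x | sgn x.1 = σ ∧ nullParam c M x ∈ feasible n V w A ∧ nullParam c M x ∈ S} :=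
  ((measurable_sgn.comp measurable_fst) (measurableSet_singleton σ)).inter
    ((measurable_nullParam c M (measurableSet_feasible V w A)).inter (measurable_nullParam c M hS))

/-- Feasibility does not exclude zero coordinates of `b_A`, where the sign is `0`; such parameters
are missed by the `±1` pieces but form a null set. -/
theorem ae_eq_iUnion_nullParam [Fintype K] (S : Set (Theta A)) :
    ({x | nullParam c M x ∈ feasible n V w A} ∩ nullParam c M ⁻¹' S : Set _)
      =ᵐ[(volume : Measure ((A → ℝ) × (K → ℝ)))]
      (⋃ τ : A → Bool, {x | sgn x.1 = signOf τ ∧ nullParam c M x ∈ feasible n V w A ∧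
        nullParam c M x ∈ S} : Set _) := by
  rw [ae_eq_set]
  constructor
  · refine measure_mono_null ?_ (volume_exists_eq_zero (ι := A) (K := K))
    rintro x ⟨⟨hf, hS⟩, hx⟩
    by_contra! h0
    simp only [Set.mem_ofPred_eq, not_exists] at h0
    obtain ⟨τ, hτ⟩ := exists_signOf_eq (σ := sgn x.1)
      fun j => (Real.sign_apply_eq_of_ne_zero _ (h0 j)).symm
    exact hx (Set.mem_iUnion.2 ⟨τ, hτ.symm, hf, hS⟩)
  · rw [Set.sdiff_eq_empty.2, measure_empty]
    refine Set.iUnion_subset fun τ x hx => ⟨hx.2.1, hx.2.2⟩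

/-- Measurability of `βhat` is derived where needed, not assumed: under the measurable equivalence
of `signResponse` the set corresponds to an explicit Borel set of parameters. -/
theorem measurableSet_activeSet_inter [Fintype K] (hn : 0 < n) (hnp : n ≤ p)
    (hX : ∀ J : Finset (Fin p), J.card = n → LinearIndependent ℝ (fun j : J => X.col j))
    (hw : ∀ j, 0 < w j) (hlam : 0 < lam)
    (huniq : ∀ y b b', IsLassoSolution X w lam y b → IsLassoSolution X w lam y b' → b = b')
    (hβ : ∀ y, IsLassoSolution X w lam y (βhat y)) (hV : IsSpectralFrame X V L)
    (hAK : A.card + Fintype.card K = n) (hM : IsNullParam n V w A c M) {σ : A → ℝ}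
    (hσ : ∀ j, σ j = 1 ∨ σ j = -1) {S : Set (Theta A)} (hS : MeasurableSet S) :
    MeasurableSet {y | activeSet (βhat y) = A ∧ sgn (lassoTheta X w lam A βhat y).1 = σ ∧
      lassoTheta X w lam A βhat y ∈ S} := by
  obtain ⟨κ, -, -, h⟩ := exists_measurableEquiv_signResponse hn hnp hX hw hlam hV hAK hM
  obtain ⟨e, he, -⟩ := h σ
  rw [← e.measurableSet_preimage, he, preimage_signResponse hn hnp hw hlam huniq hβ hV hM hσ
    (he ▸ e.injective)]
  exact measurableSet_nullParam σ hS

/-- The target measure is a multiple of the law of `(β̂_A, S_I)` on the event that the active set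
is `A`. -/
theorem exists_targetMeasure_eq [Fintype K] (hn : 0 < n) (hnp : n ≤ p)
    (hX : ∀ J : Finset (Fin p), J.card = n → LinearIndependent ℝ (fun j : J => X.col j))
    (hw : ∀ j, 0 < w j) (hlam : 0 < lam)
    (huniq : ∀ y b b', IsLassoSolution X w lam y b → IsLassoSolution X w lam y b' → b = b')
    (hβ : ∀ y, IsLassoSolution X w lam y (βhat y)) (hV : IsSpectralFrame X V L)
    (hAK : A.card + Fintype.card K = n) (hM : IsNullParam n V w A c M)
    {sig : ℝ} (hsig : 0 < sig) (m : Fin n → ℝ) {μ : Measure (Fin n → ℝ)}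
    (hμ : μ = volume.withDensity fun y =>
      ENNReal.ofReal (∏ i, gaussianPDFReal (m i) (Real.toNNReal (sig ^ 2)) (y i))) :
    MeasurableSet {y | activeSet (βhat y) = A} ∧
    AEMeasurable (lassoTheta X w lam A βhat) (μ.restrict {y | activeSet (βhat y) = A}) ∧
    ∃ κ : ENNReal, κ ≠ 0 ∧ κ ≠ ⊤ ∧ targetMeasure X w lam sig m V L A (nullParam c M) =
      κ • (μ.restrict {y | activeSet (βhat y) = A}).map (lassoTheta X w lam A βhat) := by
  classical
  have hD : ∀ (τ : A → Bool) {S : Set (Theta A)}, MeasurableSet S →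
      MeasurableSet {y | activeSet (βhat y) = A ∧
        sgn (lassoTheta X w lam A βhat y).1 = signOf τ ∧ lassoTheta X w lam A βhat y ∈ S} :=
    fun τ _ hS => measurableSet_activeSet_inter hn hnp hX hw hlam huniq hβ hV hAK hM
      (signOf_eq_or τ) hS
  have hES : ∀ {S : Set (Theta A)}, MeasurableSet S →
      MeasurableSet ({y | activeSet (βhat y) = A} ∩ lassoTheta X w lam A βhat ⁻¹' S) := by
    intro S hS
    rw [activeSet_inter_preimage_eq_iUnion]
    exact MeasurableSet.iUnion fun τ => hD τ hS
  have hE : MeasurableSet {y | activeSet (βhat y) = A} := by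
    simpa using hES MeasurableSet.univ
  have hT : AEMeasurable (lassoTheta X w lam A βhat)
      (μ.restrict {y | activeSet (βhat y) = A}) := by
    refine aemeasurable_restrict_of_measurable_subtype hE fun S hS => ?_
    rw [← MeasurableEmbedding.subtype_coe hE |>.measurableSet_image]
    convert hES hS using 1
    ext y
    simp [and_comm]
  refine ⟨hE, hT, ?_⟩
  obtain ⟨κ, hκ0, hκ, hψ⟩ := exists_measurableEquiv_signResponse hn hnp hX hw hlam hV hAK hM
  obtain ⟨C, hC, hdens⟩ := hV.exists_densR_eq hn hnp hsig m
  refine ⟨ENNReal.ofReal C * κ, mul_ne_zero (by simpa using hC) hκ0,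
    ENNReal.mul_ne_top ENNReal.ofReal_ne_top hκ, ?_⟩
  set g : (Fin n → ℝ) → ENNReal := fun y =>
    ENNReal.ofReal (∏ i, gaussianPDFReal (m i) (Real.toNNReal (sig ^ 2)) (y i)) with hg
  have hgm : Measurable g := by
    refine ENNReal.measurable_ofReal.comp (Finset.measurable_prod _ fun i _ => ?_)
    exact (measurable_gaussianPDFReal _ _).comp (measurable_pi_apply i)
  have hφ := measurable_nullParam c M
  have hfeas : MeasurableSet {x | nullParam c M x ∈ feasible n V w A} :=
    hφ (measurableSet_feasible V w A)
  have hdisj : ∀ {α : Type _} (f : α → A → ℝ) (Q : α → Prop) , Pairwise (Function.onFun Disjoint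
      fun τ : A → Bool => {y | f y = signOf τ ∧ Q y}) := by
    intro α f Q τ τ' hne
    refine Set.disjoint_left.2 fun y hy hy' => hne (signOf_injective ?_)
    rw [← hy.1, hy'.1]
  refine Measure.ext fun S hS => ?_
  -- Both sides become sums over sign vectors of integrals, over responses on one side and over
  -- parameters on the other.
  rw [Measure.smul_apply, smul_eq_mul, Measure.map_apply_of_aemeasurable hT hS,
    Measure.restrict_apply' hE, Set.inter_comm, hμ, withDensity_apply _ (hES hS),
    activeSet_inter_preimage_eq_iUnion, lintegral_iUnion (fun τ => hD τ hS), targetMeasure,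
    Measure.map_apply hφ hS, withDensity_apply _ (hφ hS), setLIntegral_indicator hfeas, setLIntegral_congr (ae_eq_iUnion_nullParam S),
    lintegral_iUnion (fun τ => measurableSet_nullParam _ hS) (hdisj _ _), ← ENNReal.tsum_mul_left]
  · refine tsum_congr fun τ => ?_
    obtain ⟨e, he, hmap⟩ := hψ (signOf τ)
    have hpre := preimage_signResponse hn hnp hw hlam huniq hβ hV hM (signOf_eq_or τ)
      (he ▸ e.injective) S
    -- The factor `κ` turns Lebesgue measure on responses into the pushforward under `e`, which
    -- moves the integral to the parameters.
    rw [mul_assoc, ← smul_eq_mul κ, ← lintegral_smul_measure, ← Measure.restrict_smul, ← hmap,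
      setLIntegral_map (hD τ hS) hgm e.measurable, he, hpre,
      ← lintegral_const_mul' _ _ ENNReal.ofReal_ne_top]
    refine setLIntegral_congr_fun (measurableSet_nullParam _ hS) fun x hx => ?_
    rw [Hmap_nullParam hn hV hM (signOf_eq_or τ) hx.1, hdens, ENNReal.ofReal_mul hC.le]
  · intro τ τ' hne
    refine Set.disjoint_left.2 fun y hy hy' => hne (signOf_injective ?_)
    rw [← hy.2.1, hy'.2.1]

end ChangeOfVariables

/-! ### The two concrete parameterizations -/

section Solve

variable {X : Matrix (Fin n) (Fin p) ℝ} {V : Matrix (Fin p) (Fin p) ℝ} {L : RIdx n p → ℝ}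
  {w : Fin p → ℝ} {A F : Finset (Fin p)}

/-- The left side of the null-space equation together with the coordinates on `F`. -/
def blockIWithCoords (n : ℕ) {p : ℕ} (V : Matrix (Fin p) (Fin p) ℝ) (w : Fin p → ℝ)
    {A F : Finset (Fin p)} (hAF : Disjoint A F) :
    (Inactive A → ℝ) →ₗ[ℝ] (NIdx n p → ℝ) × (F → ℝ) :=
  (blockI n V w A).mulVecLin.prod
    (LinearMap.funLeft ℝ ℝ fun j : F => ⟨j, Finset.disjoint_right.1 hAF j.2⟩)

theorem blockIWithCoords_apply (hAF : Disjoint A F) (s : Inactive A → ℝ) :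
    blockIWithCoords n V w hAF s =
      (blockI n V w A *ᵥ s, fun j : F => s ⟨j, Finset.disjoint_right.1 hAF j.2⟩) := rfl

/-- If `s` is in the kernel, the vector `W s` (zero on `A`) is orthogonal to `null(X)` and vanishes
on the `n` indices `A ∪ F`, so general position forces it to be zero. Surjectivity follows from `p -
|A| = (p - n) + |F|`. -/
theorem blockIWithCoords_bijective (hn : 0 < n) (hnp : n ≤ p)
    (hX : ∀ J : Finset (Fin p), J.card = n → LinearIndependent ℝ (fun j : J => X.col j))
    (hw : ∀ j, 0 < w j) (hV : IsSpectralFrame X V L) (hAF : Disjoint A F)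
    (hcard : A.card + F.card = n) : Function.Bijective (blockIWithCoords n V w hAF) := by
  have hinj : Function.Injective (blockIWithCoords n V w hAF) := by
    rw [injective_iff_map_eq_zero]
    intro s hs
    rw [blockIWithCoords_apply, Prod.mk_eq_zero] at hs
    have hnull : (colsN n V)ᵀ *ᵥ (Matrix.diagonal w *ᵥ glue A (0, s)) = 0 := by
      rw [← nullEq_iff, NullEq, Matrix.mulVec_zero, zero_add, hs.1]
    have hJ : (A ∪ F).card = n := by rw [Finset.card_union_of_disjoint hAF, hcard]
    have h0 := hV.eq_zero_of_colsN_transpose_mulVec hn hJ (hX _ hJ) hnull fun j hj => by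
      rw [Matrix.mulVec_diagonal]
      by_cases h : j ∈ A
      · simp [h]
      · have hF : j ∈ F := (Finset.mem_union.1 hj).resolve_left h
        have h1 : s ⟨j, h⟩ = 0 := congrFun hs.2 ⟨j, hF⟩
        simp [h, h1]
    ext j
    have h1 := congrFun h0 j
    rw [Matrix.mulVec_diagonal, glue_apply_notMem _ j.2] at h1
    exact (mul_eq_zero.1 h1).resolve_left (hw j).ne'
  have hfr : Module.finrank ℝ (Inactive A → ℝ) =
      Module.finrank ℝ ((NIdx n p → ℝ) × (F → ℝ)) := by
    rw [Module.finrank_prod, Module.finrank_fintype_fun_eq_card, Module.finrank_fintype_fun_eq_card,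
      Module.finrank_fintype_fun_eq_card, card_NIdx, Fintype.card_coe, Fintype.card_subtype_compl,
      Fintype.card_fin, Fintype.card_coe]
    omega
  exact ⟨hinj, (LinearMap.injective_iff_surjective_of_finrank_eq_finrank hfr).1 hinj⟩

/-- For `|A| + |F| = n` the coordinates on `F` parameterize the solutions of the null-space
equation. -/
theorem exists_isNullParam_coords (hn : 0 < n) (hnp : n ≤ p)
    (hX : ∀ J : Finset (Fin p), J.card = n → LinearIndependent ℝ (fun j : J => X.col j))
    (hw : ∀ j, 0 < w j) (hV : IsSpectralFrame X V L) (hAF : Disjoint A F)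
    (hcard : A.card + F.card = n) :
    ∃ (c : (A → ℝ) → (Inactive A → ℝ)) (M : (F → ℝ) →ₗ[ℝ] (Inactive A → ℝ)),
      IsNullParam n V w A c M ∧ ∀ σ t s, (NullEq n V w A σ s ∧
        ∀ (j : Inactive A) (hj : j.1 ∈ F), s j = t ⟨j, hj⟩) ↔ s = c σ + M t := by
  let e := LinearEquiv.ofBijective _ (blockIWithCoords_bijective hn hnp hX hw hV hAF hcard)
  have he : ∀ s, e s =
      (blockI n V w A *ᵥ s, fun j : F => s ⟨j, Finset.disjoint_right.1 hAF j.2⟩) := fun _ => rfl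
  have hsolve : ∀ σ t s, (NullEq n V w A σ s ∧
      ∀ (j : Inactive A) (hj : j.1 ∈ F), s j = t ⟨j, hj⟩) ↔
        s = e.symm (-(blockA n V w A *ᵥ σ), t) := by
    intro σ t s
    rw [LinearEquiv.eq_symm_apply, he, Prod.mk_inj, NullEq, add_comm, add_eq_zero_iff_eq_neg]
    refine and_congr_right fun _ => ⟨fun h => funext fun j => h _ j.2, fun h j hj => ?_⟩
    exact congrFun h ⟨j, hj⟩
  -- Separates the part driven by the signs, which becomes `c`, from the part linear in the free
  -- coordinates, which becomes `M`.
  have hadd : ∀ σ t, e.symm (-(blockA n V w A *ᵥ σ), t) =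
      e.symm (-(blockA n V w A *ᵥ σ), 0) + e.symm (0, t) := by
    intro σ t
    rw [← map_add, Prod.mk_add_mk, add_zero, zero_add]
  refine ⟨fun σ => e.symm (-(blockA n V w A *ᵥ σ), 0),
    e.symm.toLinearMap ∘ₗ LinearMap.inr ℝ _ _, ⟨?_, ?_, fun σ _ => ?_⟩, fun σ t s => ?_⟩
  · exact e.symm.injective.comp LinearMap.inr_injective
  · ext s
    rw [LinearMap.mem_range, LinearMap.mem_ker, Matrix.mulVecLin_apply]
    constructor
    · rintro ⟨t, rfl⟩
      exact congrArg Prod.fst ((he _).symm.trans (e.apply_symm_apply (0, t)))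
    · intro hs
      refine ⟨(e s).2, ?_⟩
      rw [LinearMap.comp_apply, LinearEquiv.coe_coe, LinearEquiv.symm_apply_eq]
      exact Prod.ext hs.symm rfl
  · exact ((hsolve σ 0 _).2 rfl).1
  · rw [hsolve, hadd]
    rfl

/-- An orthonormal basis of the null space parameterizes the solutions of the null-space
equation. -/
theorem isNullParam_mulVecLin {K : Type} [Fintype K] [DecidableEq K]
    {B : Matrix (Inactive A) K ℝ} {s0 : (A → ℝ) → (Inactive A → ℝ)} (hB : Bᵀ * B = 1)
    (hrange : LinearMap.range B.mulVecLin = LinearMap.ker (blockI n V w A).mulVecLin)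
    (hs0 : ∀ σ : A → ℝ, (∀ j, σ j = 1 ∨ σ j = -1) → NullEq n V w A σ (s0 σ)) :
    IsNullParam n V w A s0 B.mulVecLin where
  injective := by
    intro t t' h
    have h' := congrArg (Bᵀ *ᵥ ·) h
    simpa only [Matrix.mulVecLin_apply, Matrix.mulVec_mulVec, hB, Matrix.one_mulVec] using h'
  range_eq := hrange
  particular := hs0

end Solve

end CondLasso

/-! ### The conditional law -/

theorem corollary1
    {n p : ℕ} (hn : 0 < n) (hnp : n < p)
    (X : Matrix (Fin n) (Fin p) ℝ)
    (hX : ∀ J : Finset (Fin p), J.card = n → LinearIndependent ℝ (fun j : J => X.col j))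
    (w : Fin p → ℝ) (hw : ∀ j, 0 < w j)
    (lam : ℝ) (hlam : 0 < lam) (sig : ℝ) (hsig : 0 < sig)
    -- the lasso estimator, the argmin being a well-defined single point for every response
    (huniq : ∀ y b b', IsLassoSolution X w lam y b → IsLassoSolution X w lam y b' → b = b')
    (βhat : (Fin n → ℝ) → (Fin p → ℝ)) (hβ : ∀ y, IsLassoSolution X w lam y (βhat y))
    -- the orthogonal matrix `V` and the positive eigenvalues of `Ψ`
    (V : Matrix (Fin p) (Fin p) ℝ) (L : RIdx n p → ℝ) (hV : IsSpectralFrame X V L)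
    -- the Gaussian response
    {Ω : Type*} [MeasurableSpace Ω] (P : Measure Ω) [IsProbabilityMeasure P]
    (mu0 : EuclideanSpace ℝ (Fin n)) (y : Ω → EuclideanSpace ℝ (Fin n))
    (hy : HasLaw y (multivariateGaussian mu0 (sig ^ 2 • (1 : Matrix (Fin n) (Fin n) ℝ))) P)
    -- the conditioning event
    (A : Finset (Fin p)) (hA : P {ω | activeSet (βhat (y ω).ofLp) = A} ≠ 0) :
    A.card ≤ n ∧
    -- free coordinates `s_F`, for every `F ⊆ I` of size `n - |A|`
    (∀ F : Finset (Fin p), Disjoint A F → A.card + F.card = n →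
      ∃ sI : (A → ℝ) × (F → ℝ) → (Inactive A → ℝ),
        (∀ x s, (NullEq n V w A (sgn x.1) s ∧ ∀ (j : Inactive A) (hj : j.1 ∈ F), s j = x.2 ⟨j, hj⟩)
          ↔ s = sI x) ∧
        IsNormalizationOf
          ((ProbabilityTheory.cond P {ω | activeSet (βhat (y ω).ofLp) = A}).map fun ω =>
            restrictTheta A (βhat (y ω).ofLp)
              (lassoSubgradient X w lam (y ω).ofLp (βhat (y ω).ofLp)))
          (targetMeasure X w lam sig mu0.ofLp V L A fun x => (x.1, sI x))) ∧
    -- free coordinates `t` with `d s_I = B d t`, for every orthonormal basis `B` of the null space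
    (∀ (B : Matrix (Inactive A) (Fin (n - A.card)) ℝ) (s0 : (A → ℝ) → (Inactive A → ℝ)),
      Bᵀ * B = 1 →
      LinearMap.range B.mulVecLin = LinearMap.ker (blockI n V w A).mulVecLin →
      (∀ σ : A → ℝ, (∀ j, σ j = 1 ∨ σ j = -1) → NullEq n V w A σ (s0 σ)) →
        IsNormalizationOf
          ((ProbabilityTheory.cond P {ω | activeSet (βhat (y ω).ofLp) = A}).map fun ω =>
            restrictTheta A (βhat (y ω).ofLp)
              (lassoSubgradient X w lam (y ω).ofLp (βhat (y ω).ofLp)))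
          (targetMeasure X w lam sig mu0.ofLp V L A
            fun x => (x.1, s0 (sgn x.1) + B *ᵥ x.2))) := by
  have hAn : A.card ≤ n := by
    -- The bound on `|A|` is deterministic, so one outcome in the event suffices.
    have hne : {ω | activeSet (βhat (y ω).ofLp) = A}.Nonempty :=
      nonempty_of_measure_ne_zero hA
    obtain ⟨ω, hω⟩ := hne
    have h := card_activeSet_le hn hw hlam (hβ (y ω).ofLp) fun b' => huniq _ _ b' (hβ _)
    rwa [show activeSet (βhat (y ω).ofLp) = A from hω] at h
  have hlaw := hasLaw_ofLp_of_isotropic hsig hy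
  -- The index type `K` is left general: it is `F` in the first claim and `Fin (n - |A|)` in the
  -- second.
  have main : ∀ {K : Type} [Fintype K] (c : (A → ℝ) → (Inactive A → ℝ))
      (M : (K → ℝ) →ₗ[ℝ] (Inactive A → ℝ)), A.card + Fintype.card K = n →
      IsNullParam n V w A c M →
      IsNormalizationOf
        ((ProbabilityTheory.cond P {ω | activeSet (βhat (y ω).ofLp) = A}).map fun ω =>
          restrictTheta A (βhat (y ω).ofLp)
            (lassoSubgradient X w lam (y ω).ofLp (βhat (y ω).ofLp)))
        (targetMeasure X w lam sig mu0.ofLp V L A (nullParam c M)) := by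
    intro K _ c M hAK hM
    obtain ⟨hE, hT, κ, hκ0, hκ, hν⟩ := exists_targetMeasure_eq hn hnp.le hX hw hlam huniq hβ hV
      hAK hM hsig mu0.ofLp rfl
    exact IsNormalizationOf.of_hasLaw hlaw hE hT hA hκ0 hκ hν
  refine ⟨hAn, fun F hAF hcard => ?_, fun B s0 hB hrange hs0 => ?_⟩
  · obtain ⟨c, M, hM, hsolve⟩ := exists_isNullParam_coords hn hnp.le hX hw hV hAF hcard
    exact ⟨fun x => c (sgn x.1) + M x.2, fun x s => hsolve _ _ s,
      main c M (by rwa [Fintype.card_coe]) hM⟩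
  · exact main s0 B.mulVecLin (by rw [Fintype.card_fin]; omega) (isNullParam_mulVecLin hB hrange hs0)
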